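/- Let $d\ge 2$, $\mathbb{T}^d=[0,2\pi]^d$ with periodic boundary conditions, $\mathbb{Z}^d_*=\mathbb{Z}^d\setminus\{0\}$, $\hat f(k)=(2\pi)^{-d}\int_{\mathbb{T}^d}f(x)e^{-ik\cdot x}\,dx$, $\Lambda=(-\Delta)^{1/2}$ (the Fourier multiplier with symbol $|k|$). For $r,\tau>0$ put $$\|\Lambda^re^{\tau\Lambda}f\|_{L^2}^2:=\sum_{k\in\mathbb{Z}^d_*}|k|^{2r}e^{2\tau|k|}|\hat f(k)|^2 ,$$ and call a continuous real function $f$ on $\mathbb{T}^d$ analytic with radius of convergence $\tau$ (with respect to $r$) if this sum is finite. Let $T_{ij}$ $(1\le i,j\le d)$ be Fourier multiplier operators on $\mathbb{T}^d$ that map real functions to real functions and satisfy $\sum_{i,j}\partial_{x_i}\partial_{x_j}T_{ij}f=0$ for all smooth $f$, $\widehat{T_{ij}}(0)=0$ and $\sup_{k\in\mathbb{Z}^d_*}|\widehat{T_{ij}}(k)|\le C_0$, where $C_0>0$. For $\kappa\ge0$ and $\gamma\in(0,2]$ consider $$\partial_t\theta+u\cdot\nabla\theta=-\kappa\Lambda^\gamma\theta+S,\qquad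 u_j=\sum_{i}\partial_{x_i}T_{ij}[\theta],\qquad \theta(\cdot,0)=\theta_0. \qquad (*)$$ An analytic solution of $(*)$ on $[0,T)$ is a real function $\theta$ that satisfies $(*)$ pointwise on $\mathbb{T}^d\times[0,T)$ (with one-sided time derivative at $t=0$), has zero mean over $\mathbb{T}^d$ for every $t\in[0,T)$, and is such that for every $T'<T$ there are $\tau>0$ and $M<\infty$ with $\theta(\cdot,t)$ analytic with radius of convergence $\tau$ and $\|\Lambda^re^{\tau\Lambda}\theta(\cdot,t)\|_{L^2}\le M$ for all $t\in[0,T']$. **Theorem.** Let $\tau_0,K_0>0$. There is $T_*>0$, depending only on $\tau_0$ and $K_0$ (and on the fixed $d$ and $C_0$), such that the following holds for every $r>\frac d2+\frac52$, every $\kappa\ge0$, $\gamma\in(0,2]$ and all $T_{ij}$ as above. If $\theta_0$ and $S=S(x)$ are mean-zero analytic functions on $\mathbb{T}^d$ with radius of convergence $\tau_0$ (with respect to $r$) and $$\|\Lambda^re^{\tau_0\Lambda}\theta_0\|_{L^2}\le K_0,\qquad \|\Lambda^re^{\tau_0\Lambda}S\|_{L^2}\le K_0,$$ then $(*)$ has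 an analytic solution on $[0,T_*)$, and any two analytic solutions of $(*)$ on $[0,T_*)$ coincide. -/

import Mathlib

noncomputable section

namespace ActiveScalar

open MeasureTheory

/-- Functions on the torus `[0, 2π]^d`: functions on `ℝ^d` that are `2π`-periodic
in each variable. -/
def TorusPeriodic {d : ℕ} (f : (Fin d → ℝ) → ℝ) : Prop :=
  ∀ (x : Fin d → ℝ) (n : Fin d → ℤ), f (fun i => x i + 2 * Real.pi * (n i : ℝ)) = f x

/-- The fundamental cell `[0, 2π]^d`. -/
def cell (d : ℕ) : Set (Fin d → ℝ) := Set.Icc 0 (fun _ => 2 * Real.pi)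

/-- Zero average over the torus. -/
def MeanZero {d : ℕ} (f : (Fin d → ℝ) → ℝ) : Prop := ∫ x in cell d, f x = 0

/-- The Euclidean length `|k|` of a frequency `k ∈ ℤ^d`. -/
def freqNorm {d : ℕ} (k : Fin d → ℤ) : ℝ := Real.sqrt (∑ i, (k i : ℝ) ^ 2)

/-- The character `x ↦ exp (i k · x)`. -/
def character {d : ℕ} (k : Fin d → ℤ) (x : Fin d → ℝ) : ℂ :=
  Complex.exp (Complex.I * ((∑ i, (k i : ℝ) * x i : ℝ) : ℂ))

/-- The Fourier coefficient `(2π)^{-d} ∫ f(x) exp (-i k · x) dx` over the torus. -/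
def fourierCoefficient {d : ℕ} (f : (Fin d → ℝ) → ℝ) (k : Fin d → ℤ) : ℂ :=
  ((((2 * Real.pi) ^ d)⁻¹ : ℝ) : ℂ) * ∫ x in cell d, character (-k) x * (f x : ℂ)

/-- The terms `|k|^{2r} exp (2τ|k|) |f̂(k)|²`, `k ≠ 0`, of the squared norm of
`Λ^r exp (τΛ) f` in `L²`. -/
def gevreyTerm {d : ℕ} (r τ : ℝ) (f : (Fin d → ℝ) → ℝ) (k : Fin d → ℤ) : ℝ :=
  if k = 0 then 0
  else freqNorm k ^ (2 * r) * Real.exp (2 * τ * freqNorm k) * ‖fourierCoefficient f k‖ ^ 2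

/-- `f` is an analytic function on the torus with radius of convergence `τ`, in the sense
`f ∈ 𝒟(Λ^r exp (τΛ))`. Continuity selects the continuous representative. -/
structure InAnalyticClass {d : ℕ} (r τ : ℝ) (f : (Fin d → ℝ) → ℝ) : Prop where
  periodic : TorusPeriodic f
  continuous : Continuous f
  summable : Summable (gevreyTerm r τ f)

/-- The norm `‖Λ^r exp (τΛ) f‖` in `L²` (meaningful for `f` in `InAnalyticClass r τ`). -/
def analyticNorm {d : ℕ} (r τ : ℝ) (f : (Fin d → ℝ) → ℝ) : ℝ :=
  Real.sqrt (∑' k, gevreyTerm r τ f k)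

/-- The Fourier multiplier operator with symbol `m`. When `m (-k) = conj (m k)` and `f` is
real, the sum is real. -/
def fourierMultiplier {d : ℕ} (m : (Fin d → ℤ) → ℂ) (f : (Fin d → ℝ) → ℝ)
    (x : Fin d → ℝ) : ℝ :=
  (∑' k, m k * fourierCoefficient f k * character k x).re

/-- The operator `Λ^γ = (-Δ)^{γ/2}`. -/
def fracLaplacian {d : ℕ} (γ : ℝ) (f : (Fin d → ℝ) → ℝ) (x : Fin d → ℝ) : ℝ :=
  fourierMultiplier (fun k => ((freqNorm k ^ γ : ℝ) : ℂ)) f x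

/-- The `j`-th component `u_j[f] = ∑_i ∂_{x_i} T_{ij}[f]` of the drift velocity, where
`T i j` is the Fourier symbol of the operator `T_{ij}`. -/
def velocity {d : ℕ} (T : Fin d → Fin d → (Fin d → ℤ) → ℂ) (f : (Fin d → ℝ) → ℝ)
    (j : Fin d) (x : Fin d → ℝ) : ℝ :=
  fourierMultiplier (fun k => ∑ i, Complex.I * (k i : ℂ) * T i j k) f x

/-- The standing assumptions on the operators `T_{ij}`, through their Fourier symbols. -/
structure AdmissibleSymbol {d : ℕ} (C₀ : ℝ) (T : Fin d → Fin d → (Fin d → ℤ) → ℂ) :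
    Prop where
  /-- The operators map real functions to real functions. -/
  hermitian : ∀ i j k, T i j (-k) = (starRingEnd ℂ) (T i j k)
  /-- `∑_{i,j} ∂_{x_i} ∂_{x_j} T_{ij} = 0`, so that the velocity is divergence free. -/
  divergence_free : ∀ k : Fin d → ℤ, ∑ i, ∑ j, (k i : ℂ) * (k j : ℂ) * T i j k = 0
  map_zero : ∀ i j, T i j 0 = 0
  bound : ∀ i j k, k ≠ 0 → ‖T i j k‖ ≤ C₀

/-- `θ` is a (mean-zero) analytic solution on `[0, Tmax)` of
`∂_t θ + u[θ] · ∇θ = -κ Λ^γ θ + S`, `u_j[θ] = ∑_i ∂_{x_i} T_{ij}[θ]`, `θ(0) = θ₀`.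
The equation holds pointwise, with a one-sided time derivative at `t = 0`; on each
`[0, T'] ⊆ [0, Tmax)` the radius of convergence is bounded below by a positive number for
which the analytic norm stays bounded. -/
structure IsAnalyticSolution {d : ℕ} (r κ γ : ℝ) (T : Fin d → Fin d → (Fin d → ℤ) → ℂ)
    (S θ₀ : (Fin d → ℝ) → ℝ) (Tmax : ℝ) (θ : ℝ → (Fin d → ℝ) → ℝ) : Prop where
  initial : θ 0 = θ₀
  mean_zero : ∀ t ∈ Set.Ico 0 Tmax, MeanZero (θ t)
  analytic : ∀ T' < Tmax, ∃ τ > 0, ∃ M : ℝ, ∀ t ∈ Set.Icc 0 T',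
    InAnalyticClass r τ (θ t) ∧ analyticNorm r τ (θ t) ≤ M
  equation : ∀ t ∈ Set.Ico 0 Tmax, ∀ x : Fin d → ℝ,
    HasDerivWithinAt (fun s => θ s x)
      (S x - κ * fracLaplacian γ (θ t) x
        - ∑ j, velocity T (θ t) j x * fderiv ℝ (θ t) x (Pi.single j 1))
      (Set.Ico 0 Tmax) t

end ActiveScalar

end

/-!
The equation is solved on the Fourier side, in weighted `ℓ¹` spaces rather than in `L²`.

For coefficients `a t k` the transport term becomes a bilinear convolution with a kernel bounded by
`C |j| |l|`, `C = C₀ d²` (`norm_transportKernel_le`), so it loses one derivative in each factor.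
Take the radius of analyticity `ρ(t) = τ - lam t` and measure `|k| exp (ρ(t) |k|) |a t k|` by its
supremum in time inside the sum over `k`. In Duhamel's formula the shrinking radius contributes
`exp (-lam (t - s) |k|)`, whose time integral is at most `1 / (lam |k|)`; this returns the missing
derivative together with a factor `1 / lam` (`norm_duhamel_le`). The nonlinearity is then bounded
by `C / lam` times the product of the norms, and for `lam` large a contraction argument solves the
system until the radius has halved (`exists_coeff_solution`). The dissipation only helps, since
it enters through the factors `exp (-κ |k|^γ (t - s)) ≤ 1`, so `lam` depends on nothing but `C` and
the weighted `ℓ¹` norm of the data. The latter is controlled by `K₀` uniformly in `r ≥ 1`, because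
nonzero frequencies have length at least one (`InAnalyticClass.freqNorm_mul_norm_le`).
The exponential decay of the coefficients makes all the series involved converge, which turns the
Fourier-side solution into a pointwise one (`exists_analyticSolution`).

Conversely the Fourier coefficients of any analytic solution satisfy the same system
(`IsAnalyticSolution.hasDerivWithinAt_coeff`). For the difference of two solutions the estimate
above, with a radius which shrinks fast enough in terms of the decay of both, shows that its
weighted norm is bounded by a fraction of itself on a short time interval
(`coeff_unique_of_short`). The length of the interval is uniform on `[0, T']`, so finitely many
steps give uniqueness.
-/

open MeasureTheory Filter Topology Set
open scoped Pointwise BoundedContinuousFunction ENNReal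

namespace ActiveScalar

variable {d : ℕ}

/-! ### Characters and Fourier coefficients on the torus -/

lemma character_eq (k : Fin d → ℤ) (x : Fin d → ℝ) :
    character k x = ∏ i, Complex.exp (Complex.I * ((k i : ℝ) * x i : ℝ)) := by
  rw [character, ← Complex.exp_sum]
  push_cast
  rw [Finset.mul_sum]

lemma norm_character (k : Fin d → ℤ) (x : Fin d → ℝ) : ‖character k x‖ = 1 := by
  rw [character, mul_comm, Complex.norm_exp_ofReal_mul_I]

lemma character_add (k l : Fin d → ℤ) (x : Fin d → ℝ) :
    character (k + l) x = character k x * character l x := by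
  simp only [character, ← Complex.exp_add]
  congr 1
  push_cast [Pi.add_apply]
  rw [← mul_add, ← Finset.sum_add_distrib]
  simp only [add_mul]

lemma character_neg (k : Fin d → ℤ) (x : Fin d → ℝ) :
    character (-k) x = (starRingEnd ℂ) (character k x) := by
  simp only [character, ← Complex.exp_conj]
  congr 1
  push_cast [Pi.neg_apply, map_mul, Complex.conj_I, Complex.conj_ofReal, map_sum]
  simp [Finset.sum_neg_distrib]

@[fun_prop]
lemma continuous_character (k : Fin d → ℤ) : Continuous (character k) := by
  unfold character
  fun_prop

lemma character_periodic (k : Fin d → ℤ) (x : Fin d → ℝ) (n : Fin d → ℤ) :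
    character k (fun i => x i + 2 * Real.pi * (n i : ℝ)) = character k x := by
  rw [character_eq, character_eq]
  refine Finset.prod_congr rfl fun i _ => ?_
  rw [Complex.exp_eq_exp_iff_exists_int]
  exact ⟨k i * n i, by push_cast; ring⟩

lemma isCompact_cell : IsCompact (cell d) := isCompact_Icc

/-- The characters have mean zero, except for the constant one. -/
lemma integral_character (k : Fin d → ℤ) :
    ∫ x in cell d, character k x = if k = 0 then (((2 * Real.pi) ^ d : ℝ) : ℂ) else 0 := by
  have hcell : cell d = Set.univ.pi fun _ => Set.Icc 0 (2 * Real.pi) := by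
    rw [cell, Set.pi_univ_Icc]; rfl
  have h1 : ∫ x in cell d, character k x
      = ∏ i, ∫ y in Set.Icc 0 (2 * Real.pi), Complex.exp (Complex.I * ((k i : ℝ) * y : ℝ)) := by
    rw [hcell, volume_pi, Measure.restrict_pi_pi]
    simp_rw [character_eq]
    exact integral_fintype_prod_eq_prod (𝕜 := ℂ)
      (fun i (y : ℝ) => Complex.exp (Complex.I * ((k i : ℝ) * y : ℝ)))
  have h2 (n : ℤ) : ∫ y in Set.Icc 0 (2 * Real.pi), Complex.exp (Complex.I * ((n : ℝ) * y : ℝ))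
      = if n = 0 then ((2 * Real.pi : ℝ) : ℂ) else 0 := by
    rw [integral_Icc_eq_integral_Ioc, ← intervalIntegral.integral_of_le (by positivity)]
    split_ifs with hn
    · simp [hn]
    · have hc : Complex.I * (n : ℂ) ≠ 0 := mul_ne_zero Complex.I_ne_zero (by exact_mod_cast hn)
      have := integral_exp_mul_complex (a := 0) (b := 2 * Real.pi) hc
      have h3 : ∀ y : ℝ, Complex.exp (Complex.I * ((n : ℝ) * y : ℝ))
          = Complex.exp (Complex.I * (n : ℂ) * y) := fun y => by push_cast; ring_nf
      simp_rw [h3]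
      rw [this]
      have : Complex.exp (Complex.I * (n : ℂ) * ((2 * Real.pi : ℝ) : ℂ)) = 1 := by
        rw [Complex.exp_eq_one_iff]; exact ⟨n, by push_cast; ring⟩
      rw [this]; simp
  rw [h1]
  simp_rw [h2]
  split_ifs with hk
  · simp [hk]
  · obtain ⟨i, hi⟩ := Function.ne_iff.mp hk
    exact Finset.prod_eq_zero (Finset.mem_univ i) (if_neg hi)

/-- The Fourier coefficients of an absolutely convergent trigonometric series are its
coefficients. -/
lemma fourierCoefficient_of_hasSum {f : (Fin d → ℝ) → ℝ} {c : (Fin d → ℤ) → ℂ}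
    (hc : Summable fun k => ‖c k‖) (hf : ∀ x, HasSum (fun k => c k * character k x) (f x : ℂ))
    (k : Fin d → ℤ) : fourierCoefficient f k = c k := by
  have hfin : volume (cell d) ≠ ⊤ := isCompact_cell.measure_lt_top.ne
  have : IsFiniteMeasure (volume.restrict (cell d)) :=
    ⟨by rw [Measure.restrict_apply_univ]; exact isCompact_cell.measure_lt_top⟩
  have h1 : ∀ x, character (-k) x * (f x : ℂ) = ∑' l, c l * character (l - k) x := by
    intro x
    rw [← (hf x).tsum_eq, ← tsum_mul_left]
    refine tsum_congr fun l => ?_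
    rw [sub_eq_add_neg, character_add]; ring
  have h2 : ∀ l, ∫ x in cell d, c l * character (l - k) x
      = if l = k then c k * (((2 * Real.pi) ^ d : ℝ) : ℂ) else 0 := by
    intro l
    rw [integral_const_mul, integral_character]
    by_cases h : l = k
    · simp [h]
    · simp [h, sub_eq_zero]
  have h3 : HasSum (fun l => ∫ x in cell d, c l * character (l - k) x)
      (∫ x in cell d, ∑' l, c l * character (l - k) x) := by
    refine hasSum_integral_of_summable_integral_norm (fun l => ?_) ?_
    · exact (continuous_const.mul (continuous_character _)).integrableOn_Icc
    · simp only [norm_mul, norm_character, mul_one, integral_const, smul_eq_mul]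
      exact hc.mul_left _
  rw [fourierCoefficient]
  simp_rw [h1]
  rw [← h3.tsum_eq]
  simp_rw [h2]
  rw [tsum_ite_eq]
  have : (((2 * Real.pi) ^ d : ℝ) : ℂ) ≠ 0 := by
    exact_mod_cast (by positivity : (2 * Real.pi) ^ d ≠ 0)
  push_cast at this ⊢
  field_simp

/-- A continuous periodic function seen on Mathlib's torus `(ℝ/ℤ)^d`. -/
noncomputable def toUnitTorus (f : (Fin d → ℝ) → ℝ) (y : UnitAddTorus (Fin d)) : ℂ :=
  f fun i => 2 * Real.pi * (AddCircle.equivIco 1 0 (y i) : ℝ)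

lemma toUnitTorus_coe {f : (Fin d → ℝ) → ℝ} (hf : TorusPeriodic f) (x : Fin d → ℝ) :
    toUnitTorus f (fun i => (x i : UnitAddCircle)) = f ((2 * Real.pi) • x) := by
  have h : ∀ i, ∃ n : ℤ, x i = (AddCircle.equivIco 1 0 (x i : UnitAddCircle) : ℝ) + n := by
    intro i
    refine ⟨⌊x i⌋, ?_⟩
    have : (AddCircle.equivIco 1 0 (x i : UnitAddCircle) : ℝ) = Int.fract (x i) := by
      rw [AddCircle.coe_equivIco_mk_apply]; simp
    rw [this, Int.fract_add_floor]
  choose n hn using h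
  have := hf (fun i => 2 * Real.pi * (AddCircle.equivIco 1 0 (x i : UnitAddCircle) : ℝ)) n
  rw [toUnitTorus, ← this]
  congr 2
  funext i
  rw [Pi.smul_apply, smul_eq_mul, ← mul_add, ← hn]

lemma continuous_toUnitTorus {f : (Fin d → ℝ) → ℝ} (hf : TorusPeriodic f)
    (hc : Continuous f) : Continuous (toUnitTorus f) := by
  have hq : IsOpenQuotientMap (Pi.map fun (_ : Fin d) (t : ℝ) => (t : UnitAddCircle)) :=
    IsOpenQuotientMap.piMap fun _ => QuotientAddGroup.isOpenQuotientMap_mk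
  refine hq.isQuotientMap.continuous_iff.mpr ?_
  have : (toUnitTorus f ∘ Pi.map fun (_ : Fin d) (t : ℝ) => (t : UnitAddCircle))
      = fun x => ((f ((2 * Real.pi) • x) : ℝ) : ℂ) := by
    funext x
    exact toUnitTorus_coe hf x
  rw [this]
  fun_prop

lemma mFourier_coe (k : Fin d → ℤ) (x : Fin d → ℝ) :
    UnitAddTorus.mFourier k (fun i => (x i : UnitAddCircle)) = character k ((2 * Real.pi) • x) := by
  simp only [UnitAddTorus.mFourier, ContinuousMap.coe_mk, fourier_coe_apply, character_eq]
  refine Finset.prod_congr rfl fun i _ => ?_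
  congr 1
  simp only [Pi.smul_apply, smul_eq_mul]
  push_cast
  ring

lemma mFourierCoeff_toUnitTorus {f : (Fin d → ℝ) → ℝ} (hf : TorusPeriodic f)
    (k : Fin d → ℤ) :
    UnitAddTorus.mFourierCoeff (toUnitTorus f) k = fourierCoefficient f k := by
  rw [UnitAddTorus.mFourierCoeff_eq_integral _ _ 0]
  have h2 : {x : Fin d → ℝ | ∀ i, x i ∈ Ioc ((0 : Fin d → ℝ) i) ((0 : Fin d → ℝ) i + 1)}
      =ᵐ[volume] Set.Icc (0 : Fin d → ℝ) 1 := by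
    have := Measure.univ_pi_Ioc_ae_eq_Icc (μ := fun _ : Fin d => (volume : Measure ℝ))
      (f := 0) (g := 1)
    rw [← volume_pi] at this
    rw [show {x : Fin d → ℝ | ∀ i, x i ∈ Ioc ((0 : Fin d → ℝ) i) ((0 : Fin d → ℝ) i + 1)}
      = univ.pi fun i => Ioc ((0 : Fin d → ℝ) i) ((1 : Fin d → ℝ) i) from by ext x; simp]
    exact this
  rw [setIntegral_congr_set h2]
  simp_rw [mFourier_coe, toUnitTorus_coe hf, smul_eq_mul]
  rw [Measure.setIntegral_comp_smul_of_pos volume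
    (fun x => character (-k) x * (f x : ℂ)) _ (by positivity : 0 < 2 * Real.pi)]
  have h3 : (2 * Real.pi) • Set.Icc (0 : Fin d → ℝ) 1 = cell d := by
    rw [cell]
    ext x
    rw [Set.mem_smul_set_iff_inv_smul_mem₀ (by positivity)]
    simp only [Set.mem_Icc, Pi.le_def, Pi.smul_apply, smul_eq_mul, Pi.zero_apply, Pi.one_apply]
    have h : (0 : ℝ) < 2 * Real.pi := by positivity
    constructor
    · rintro ⟨h1, h2⟩
      refine ⟨fun i => ?_, fun i => ?_⟩
      · have := h1 i; rwa [inv_mul_eq_div, le_div_iff₀ h, zero_mul] at this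
      · have := h2 i; rwa [inv_mul_eq_div, div_le_iff₀ h, one_mul] at this
    · rintro ⟨h1, h2⟩
      refine ⟨fun i => ?_, fun i => ?_⟩
      · rw [inv_mul_eq_div, le_div_iff₀ h, zero_mul]; exact h1 i
      · rw [inv_mul_eq_div, div_le_iff₀ h, one_mul]; exact h2 i
  rw [h3, fourierCoefficient, Module.finrank_fin_fun, Complex.real_smul]

/-- A continuous periodic function is the sum of its Fourier series, if that series converges
absolutely. -/
lemma hasSum_fourier {f : (Fin d → ℝ) → ℝ} (hf : TorusPeriodic f) (hc : Continuous f)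
    (hs : Summable fun k => ‖fourierCoefficient f k‖) (x : Fin d → ℝ) :
    HasSum (fun k => fourierCoefficient f k * character k x) (f x : ℂ) := by
  let F : C(UnitAddTorus (Fin d), ℂ) := ⟨toUnitTorus f, continuous_toUnitTorus hf hc⟩
  have hF : UnitAddTorus.mFourierCoeff F = fourierCoefficient f :=
    funext fun k => mFourierCoeff_toUnitTorus hf k
  have h1 : Summable (UnitAddTorus.mFourierCoeff F) := by rw [hF]; exact hs.of_norm
  have h2 := UnitAddTorus.hasSum_mFourier_series_apply_of_summable h1
    (fun i => (((2 * Real.pi)⁻¹ • x) i : UnitAddCircle))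
  have h3 : F (fun i => (((2 * Real.pi)⁻¹ • x) i : UnitAddCircle)) = f x := by
    refine (toUnitTorus_coe hf _).trans ?_
    rw [smul_inv_smul₀ (by positivity)]
  rw [h3, hF] at h2
  simp_rw [mFourier_coe, smul_inv_smul₀ (by positivity : 2 * Real.pi ≠ 0), smul_eq_mul] at h2
  exact h2

lemma fourierCoefficient_neg (f : (Fin d → ℝ) → ℝ) (k : Fin d → ℤ) :
    fourierCoefficient f (-k) = (starRingEnd ℂ) (fourierCoefficient f k) := by
  rw [fourierCoefficient, fourierCoefficient, map_mul, Complex.conj_ofReal, ← integral_conj]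
  congr 2
  funext x
  rw [map_mul, Complex.conj_ofReal, character_neg (-k)]

lemma fourierCoefficient_zero {f : (Fin d → ℝ) → ℝ} (hf : MeanZero f) :
    fourierCoefficient f 0 = 0 := by
  have : ∀ x : Fin d → ℝ, character (-0) x * (f x : ℂ) = (f x : ℂ) := by
    intro x; simp [character]
  rw [fourierCoefficient]
  simp_rw [this]
  rw [integral_complex_ofReal, hf]
  simp

lemma meanZero_of_fourierCoefficient {f : (Fin d → ℝ) → ℝ} (hf : fourierCoefficient f 0 = 0) :
    MeanZero f := by
  have h : ∀ x : Fin d → ℝ, character (-0) x * (f x : ℂ) = (f x : ℂ) := by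
    intro x; simp [character]
  rw [fourierCoefficient] at hf
  simp_rw [h] at hf
  rw [integral_complex_ofReal, mul_eq_zero] at hf
  rcases hf with hf | hf
  · have : ((2 * Real.pi) ^ d)⁻¹ = 0 := by exact_mod_cast hf
    exact absurd this (by positivity)
  · exact_mod_cast hf

/-- Differentiation under the integral sign for Fourier coefficients, with a derivative within a
set. -/
lemma hasDerivWithinAt_fourierCoefficient {u : ℝ → (Fin d → ℝ) → ℝ} {F : (Fin d → ℝ) → ℝ}
    {I : Set ℝ} {t L : ℝ} (hu : ∀ᶠ s in 𝓝[I \ {t}] t, Continuous (u s)) (hut : Continuous (u t))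
    (hd : ∀ x, HasDerivWithinAt (fun s => u s x) (F x) I t)
    (hL : ∀ᶠ s in 𝓝[I \ {t}] t, ∀ x, |u s x - u t x| ≤ L * |s - t|) (k : Fin d → ℤ) :
    HasDerivWithinAt (fun s => fourierCoefficient (u s) k) (fourierCoefficient F k) I t := by
  have : IsFiniteMeasure (volume.restrict (cell d)) :=
    ⟨by rw [Measure.restrict_apply_univ]; exact isCompact_cell.measure_lt_top⟩
  rw [hasDerivWithinAt_iff_tendsto_slope]
  have hint : ∀ {g : (Fin d → ℝ) → ℝ}, Continuous g →
      IntegrableOn (fun x => character (-k) x * (g x : ℂ)) (cell d) := fun hg =>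
    Continuous.integrableOn_Icc (by fun_prop)
  have hmain : Tendsto (fun s => ∫ x in cell d, character (-k) x * ((slope (fun s => u s x) t s : ℝ) : ℂ))
      (𝓝[I \ {t}] t) (𝓝 (∫ x in cell d, character (-k) x * (F x : ℂ))) := by
    refine tendsto_integral_filter_of_dominated_convergence (fun _ => L) ?_ ?_
      (integrable_const L) ?_
    · filter_upwards [hu] with s hs
      refine Continuous.aestronglyMeasurable ?_
      simp only [slope_def_field]
      fun_prop
    · filter_upwards [hL, self_mem_nhdsWithin] with s hs hst
      refine Eventually.of_forall fun x => ?_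
      rw [norm_mul, norm_character, one_mul, Complex.norm_real, slope_def_field, norm_div,
        Real.norm_eq_abs, Real.norm_eq_abs, div_le_iff₀ (abs_pos.mpr (sub_ne_zero.mpr hst.2))]
      exact hs x
    · refine Eventually.of_forall fun x => ?_
      have := (hasDerivWithinAt_iff_tendsto_slope.mp (hd x))
      exact ((Complex.continuous_ofReal.tendsto _).comp this).const_mul _
  refine (hmain.const_mul ((((2 * Real.pi) ^ d)⁻¹ : ℝ) : ℂ)).congr' ?_
  filter_upwards [hu] with s hs
  rw [slope_def_module, fourierCoefficient, fourierCoefficient, ← mul_sub,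
    ← integral_sub (hint hs) (hint hut), Complex.real_smul, mul_left_comm,
    ← integral_const_mul (((s - t)⁻¹ : ℝ) : ℂ)]
  congr 2
  funext x
  rw [slope_def_module, smul_eq_mul]
  push_cast
  ring

/-! ### Frequencies -/

lemma freqNorm_eq_norm (k : Fin d → ℤ) :
    freqNorm k = ‖(WithLp.toLp 2 fun i => (k i : ℝ) : EuclideanSpace ℝ (Fin d))‖ := by
  simp [freqNorm, EuclideanSpace.norm_eq]

lemma freqNorm_nonneg (k : Fin d → ℤ) : 0 ≤ freqNorm k := Real.sqrt_nonneg _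

@[simp] lemma freqNorm_zero : freqNorm (0 : Fin d → ℤ) = 0 := by simp [freqNorm]

@[simp] lemma freqNorm_neg (k : Fin d → ℤ) : freqNorm (-k) = freqNorm k := by simp [freqNorm]

lemma freqNorm_add_le (k l : Fin d → ℤ) : freqNorm (k + l) ≤ freqNorm k + freqNorm l := by
  simp only [freqNorm_eq_norm]
  refine le_trans (le_of_eq ?_) (norm_add_le _ _)
  congr 1
  ext i
  simp

lemma freqNorm_le_add_sub (k j : Fin d → ℤ) : freqNorm k ≤ freqNorm j + freqNorm (k - j) := by
  simpa using freqNorm_add_le j (k - j)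

lemma abs_coord_le_freqNorm (k : Fin d → ℤ) (i : Fin d) : |(k i : ℝ)| ≤ freqNorm k := by
  rw [freqNorm, ← Real.sqrt_sq_eq_abs]
  exact Real.sqrt_le_sqrt (Finset.single_le_sum (f := fun i => (k i : ℝ) ^ 2)
    (fun i _ => sq_nonneg _) (Finset.mem_univ i))

lemma one_le_freqNorm {k : Fin d → ℤ} (hk : k ≠ 0) : 1 ≤ freqNorm k := by
  obtain ⟨i, hi⟩ := Function.ne_iff.mp hk
  refine le_trans ?_ (abs_coord_le_freqNorm k i)
  exact_mod_cast Int.one_le_abs hi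

lemma freqNorm_pos {k : Fin d → ℤ} (hk : k ≠ 0) : 0 < freqNorm k :=
  zero_lt_one.trans_le (one_le_freqNorm hk)

lemma summable_prod_coord {f : ℤ → ℝ} (hf : ∀ n, 0 ≤ f n) (hs : Summable f) :
    ∀ d : ℕ, Summable fun k : Fin d → ℤ => ∏ i, f (k i)
  | 0 => (hasSum_fintype _).summable
  | d + 1 => by
    rw [← (Fin.consEquiv fun _ => ℤ).summable_iff]
    have := Summable.mul_of_nonneg hs (summable_prod_coord hf hs d) (fun n => hf n)
      (fun k => Finset.prod_nonneg fun i _ => hf _)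
    refine this.congr fun p => ?_
    simp [Fin.prod_univ_succ, Fin.consEquiv]

lemma summable_exp_freqNorm {c : ℝ} (hc : 0 < c) :
    Summable fun k : Fin d → ℤ => Real.exp (-c * freqNorm k) := by
  rcases Nat.eq_zero_or_pos d with rfl | hd
  · exact (hasSum_fintype _).summable
  have hd' : (0 : ℝ) < d := by exact_mod_cast hd
  have h1 : Summable fun n : ℤ => Real.exp (-(c / d) * |(n : ℝ)|) := by
    have h : Summable fun n : ℕ => Real.exp (n * (-(c / d))) :=
      Real.summable_exp_nat_mul_iff.mpr (by simp only [neg_lt_zero]; positivity)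
    refine Summable.of_nat_of_neg (h.congr fun n => ?_) (h.congr fun n => ?_) <;>
    · congr 1
      simp [mul_comm]
  refine Summable.of_nonneg_of_le (fun k => (Real.exp_pos _).le) (fun k => ?_)
    (summable_prod_coord (fun n => (Real.exp_pos _).le) h1 d)
  rw [← Real.exp_sum, Real.exp_le_exp, ← Finset.mul_sum]
  have h2 : ∑ i, |(k i : ℝ)| ≤ d * freqNorm k := by
    refine (Finset.sum_le_sum fun i _ => abs_coord_le_freqNorm k i).trans ?_
    simp
  have : c / d * ∑ i, |(k i : ℝ)| ≤ c / d * (d * freqNorm k) := by gcongr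
  have h3 : c / d * (d * freqNorm k) = c * freqNorm k := by field_simp
  linarith

lemma exists_rpow_le_exp (s : ℝ) {c : ℝ} (hc : 0 < c) :
    ∃ C : ℝ, 0 < C ∧ ∀ x : ℝ, 1 ≤ x → x ^ s ≤ C * Real.exp (c * x) := by
  refine ⟨(⌈s⌉₊).factorial / c ^ ⌈s⌉₊, by positivity, fun x hx => ?_⟩
  have h1 : x ^ s ≤ x ^ ⌈s⌉₊ := by
    rw [← Real.rpow_natCast]
    exact Real.rpow_le_rpow_of_exponent_le hx (Nat.le_ceil s)
  have h2 := Real.pow_div_factorial_le_exp (c * x) (by positivity) ⌈s⌉₊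
  rw [mul_pow, div_le_iff₀ (by positivity)] at h2
  refine h1.trans ?_
  rw [div_mul_eq_mul_div, le_div_iff₀ (by positivity)]
  linarith

/-- Exponentially decaying sequences are summable against all real powers of the frequency. At the
zero frequency `0 ^ s` is `0` or `1`, so negative `s` is allowed too. -/
lemma summable_rpow_mul_of_decay {c : (Fin d → ℤ) → ℝ} {M σ : ℝ} (hσ : 0 < σ)
    (hc0 : ∀ k, 0 ≤ c k) (hc : ∀ k, c k ≤ M * Real.exp (-σ * freqNorm k)) (s : ℝ) :
    Summable fun k => freqNorm k ^ s * c k := by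
  obtain ⟨C, hC, h⟩ := exists_rpow_le_exp s (half_pos hσ)
  have hM : 0 ≤ M := by simpa using (hc0 0).trans (hc 0)
  have h0 := (summable_exp_freqNorm (d := d) (half_pos hσ)).mul_left (C * M + M)
  refine Summable.of_nonneg_of_le
    (fun k => mul_nonneg (Real.rpow_nonneg (freqNorm_nonneg k) _) (hc0 k)) (fun k => ?_) h0
  by_cases hk : k = 0
  · subst hk
    have h1 : (0 : ℝ) ^ s ≤ 1 := by
      by_cases hs : s = 0
      · simp [hs]
      · simp [Real.zero_rpow hs]
    have h2 := hc 0
    simp only [freqNorm_zero, mul_zero, Real.exp_zero, mul_one] at h2 ⊢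
    have h3 := hc0 0
    have : 0 ≤ C * M := by positivity
    have : (0 : ℝ) ^ s * c 0 ≤ 1 * c 0 := by gcongr
    linarith
  · have h1 := h _ (one_le_freqNorm hk)
    have h2 : Real.exp (σ / 2 * freqNorm k) * Real.exp (-σ * freqNorm k)
        = Real.exp (-(σ / 2) * freqNorm k) := by
      rw [← Real.exp_add]; ring_nf
    calc freqNorm k ^ s * c k
        ≤ (C * Real.exp (σ / 2 * freqNorm k)) * (M * Real.exp (-σ * freqNorm k)) := by
          gcongr
          · exact hc0 k
          · exact hc k
      _ = C * M * Real.exp (-(σ / 2) * freqNorm k) := by rw [← h2]; ring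
      _ ≤ _ := by
          have := Real.exp_pos (-(σ / 2) * freqNorm k)
          have : 0 ≤ M * Real.exp (-(σ / 2) * freqNorm k) := by positivity
          nlinarith

lemma summable_of_decay {c : (Fin d → ℤ) → ℝ} {M σ : ℝ} (hσ : 0 < σ)
    (hc0 : ∀ k, 0 ≤ c k) (hc : ∀ k, c k ≤ M * Real.exp (-σ * freqNorm k)) : Summable c := by
  simpa using summable_rpow_mul_of_decay hσ hc0 hc 0

lemma summable_freqNorm_mul_of_decay {c : (Fin d → ℤ) → ℝ} {M σ : ℝ} (hσ : 0 < σ)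
    (hc0 : ∀ k, 0 ≤ c k) (hc : ∀ k, c k ≤ M * Real.exp (-σ * freqNorm k)) :
    Summable fun k => freqNorm k * c k := by
  simpa using summable_rpow_mul_of_decay hσ hc0 hc 1

/-! ### Convolutions -/

/-- The change of variables `(k, j) ↦ (j, k - j)` behind convolutions. -/
def convEquiv (G : Type*) [AddCommGroup G] : G × G ≃ G × G where
  toFun p := (p.2, p.1 - p.2)
  invFun p := (p.1 + p.2, p.1)
  left_inv p := by simp
  right_inv p := by simp

section Convolution

variable {G : Type*} [AddCommGroup G] {α β : G → ℝ}

lemma hasSum_conv_prod (hα : ∀ k, 0 ≤ α k) (hβ : ∀ k, 0 ≤ β k) (hαs : Summable α)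
    (hβs : Summable β) :
    HasSum (fun p : G × G => α p.2 * β (p.1 - p.2)) ((∑' k, α k) * ∑' k, β k) := by
  have h := hαs.hasSum.mul hβs.hasSum (hαs.mul_of_nonneg hβs hα hβ)
  exact (convEquiv G).hasSum_iff.mpr h

lemma summable_conv (hα : ∀ k, 0 ≤ α k) (hβ : ∀ k, 0 ≤ β k) (hαs : Summable α)
    (hβs : Summable β) (k : G) : Summable fun j => α j * β (k - j) :=
  (hasSum_conv_prod hα hβ hαs hβs).summable.prod_factor k

/-- Young's inequality for the convolution of two `ℓ¹` sequences (here an equality). -/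
lemma hasSum_conv (hα : ∀ k, 0 ≤ α k) (hβ : ∀ k, 0 ≤ β k) (hαs : Summable α)
    (hβs : Summable β) :
    HasSum (fun k => ∑' j, α j * β (k - j)) ((∑' k, α k) * ∑' k, β k) :=
  (hasSum_conv_prod hα hβ hαs hβs).prod_fiberwise fun k =>
    (summable_conv hα hβ hαs hβs k).hasSum

end Convolution

/-- The Cauchy product of two absolutely convergent series of complex numbers over a group. -/
lemma hasSum_conv_of_norm {G : Type*} [AddCommGroup G] {f g : G → ℂ} {x y : ℂ}
    (hf : HasSum f x) (hg : HasSum g y) (hfn : Summable fun k => ‖f k‖)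
    (hgn : Summable fun k => ‖g k‖) :
    HasSum (fun p : G × G => f p.2 * g (p.1 - p.2)) (x * y) :=
  (convEquiv G).hasSum_iff.mpr (hf.mul hg (summable_mul_of_summable_norm hfn hgn))

/-- The bilinear convolution `∑_{j + l = k} m(j, l) a_j b_l` with kernel `m`. -/
noncomputable def bilin (m : (Fin d → ℤ) → (Fin d → ℤ) → ℂ) (a b : (Fin d → ℤ) → ℂ)
    (k : Fin d → ℤ) : ℂ := ∑' j, m j (k - j) * a j * b (k - j)

/-- The symbol of the drift velocity. -/
noncomputable def driftSymbol (T : Fin d → Fin d → (Fin d → ℤ) → ℂ) (q : Fin d)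
    (k : Fin d → ℤ) : ℂ := ∑ i, Complex.I * (k i : ℂ) * T i q k

/-- The kernel of the transport term `u[a] · ∇ b` on the Fourier side. -/
noncomputable def transportKernel (T : Fin d → Fin d → (Fin d → ℤ) → ℂ)
    (j l : Fin d → ℤ) : ℂ := ∑ q, driftSymbol T q j * (Complex.I * (l q : ℂ))

section Symbols

variable {C₀ : ℝ} {T : Fin d → Fin d → (Fin d → ℤ) → ℂ}

lemma norm_driftSymbol_le (hT : AdmissibleSymbol C₀ T) (q : Fin d)
    (k : Fin d → ℤ) : ‖driftSymbol T q k‖ ≤ C₀ * d * freqNorm k := by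
  by_cases hk : k = 0
  · simp [hk, driftSymbol]
  refine (norm_sum_le _ _).trans ?_
  calc ∑ i, ‖Complex.I * (k i : ℂ) * T i q k‖ ≤ ∑ _i : Fin d, freqNorm k * C₀ := by
        refine Finset.sum_le_sum fun i _ => ?_
        rw [norm_mul, norm_mul, Complex.norm_I, one_mul]
        have h := abs_coord_le_freqNorm k i
        have h1 : ‖(k i : ℂ)‖ = |(k i : ℝ)| := by simp
        rw [h1]
        exact mul_le_mul h (hT.bound i q k hk) (norm_nonneg _) (freqNorm_nonneg k)
    _ = C₀ * d * freqNorm k := by simp; ring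

lemma norm_transportKernel_le (hC₀ : 0 ≤ C₀) (hT : AdmissibleSymbol C₀ T)
    (j l : Fin d → ℤ) :
    ‖transportKernel T j l‖ ≤ C₀ * d ^ 2 * freqNorm j * freqNorm l := by
  refine (norm_sum_le _ _).trans ?_
  calc ∑ q, ‖driftSymbol T q j * (Complex.I * (l q : ℂ))‖
      ≤ ∑ _q : Fin d, C₀ * d * freqNorm j * freqNorm l := by
        refine Finset.sum_le_sum fun q _ => ?_
        rw [norm_mul, norm_mul, Complex.norm_I, one_mul]
        have h := abs_coord_le_freqNorm l q
        have h1 : ‖(l q : ℂ)‖ = |(l q : ℝ)| := by simp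
        rw [h1]
        exact mul_le_mul (norm_driftSymbol_le hT q j) h (abs_nonneg _)
          (mul_nonneg (by positivity) (freqNorm_nonneg j))
    _ = _ := by simp; ring

lemma driftSymbol_neg (hT : AdmissibleSymbol C₀ T) (q : Fin d) (k : Fin d → ℤ) :
    driftSymbol T q (-k) = (starRingEnd ℂ) (driftSymbol T q k) := by
  simp [driftSymbol, hT.hermitian]

lemma transportKernel_neg (hT : AdmissibleSymbol C₀ T) (j l : Fin d → ℤ) :
    transportKernel T (-j) (-l) = (starRingEnd ℂ) (transportKernel T j l) := by
  simp [transportKernel, driftSymbol_neg hT]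

/-- The drift is divergence free, so the transport term has mean zero. -/
lemma transportKernel_self_neg (hT : AdmissibleSymbol C₀ T) (j : Fin d → ℤ) :
    transportKernel T j (-j) = 0 := by
  have h : transportKernel T j (-j) = ∑ q, ∑ i, (j i : ℂ) * (j q : ℂ) * T i q j := by
    simp only [transportKernel, driftSymbol, Finset.sum_mul]
    refine Finset.sum_congr rfl fun q _ => Finset.sum_congr rfl fun i _ => ?_
    push_cast [Pi.neg_apply]
    linear_combination (-(j i : ℂ) * T i q j * j q) * Complex.I_mul_I
  rw [h, Finset.sum_comm]
  exact hT.divergence_free j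

end Symbols

section Bilin

variable {m : (Fin d → ℤ) → (Fin d → ℤ) → ℂ} {C : ℝ} {a b a' b' : (Fin d → ℤ) → ℂ}

lemma norm_bilin_term_le (hm : ∀ j l, ‖m j l‖ ≤ C * freqNorm j * freqNorm l)
    (k j : Fin d → ℤ) :
    ‖m j (k - j) * a j * b (k - j)‖
      ≤ C * ((freqNorm j * ‖a j‖) * (freqNorm (k - j) * ‖b (k - j)‖)) := by
  rw [norm_mul, norm_mul]
  calc _ ≤ (C * freqNorm j * freqNorm (k - j)) * ‖a j‖ * ‖b (k - j)‖ := by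
        gcongr; exact hm _ _
    _ = _ := by ring

lemma summable_bilin_term (hm : ∀ j l, ‖m j l‖ ≤ C * freqNorm j * freqNorm l)
    (ha : Summable fun k => freqNorm k * ‖a k‖) (hb : Summable fun k => freqNorm k * ‖b k‖)
    (k : Fin d → ℤ) : Summable fun j => ‖m j (k - j) * a j * b (k - j)‖ :=
  Summable.of_nonneg_of_le (fun _ => norm_nonneg _) (norm_bilin_term_le hm k)
    ((summable_conv (fun j => mul_nonneg (freqNorm_nonneg j) (norm_nonneg (a j)))
      (fun j => mul_nonneg (freqNorm_nonneg j) (norm_nonneg (b j))) ha hb k).mul_left C)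

lemma bilin_sub_left (hm : ∀ j l, ‖m j l‖ ≤ C * freqNorm j * freqNorm l)
    (ha : Summable fun k => freqNorm k * ‖a k‖) (ha' : Summable fun k => freqNorm k * ‖a' k‖)
    (hb : Summable fun k => freqNorm k * ‖b k‖) (k : Fin d → ℤ) :
    bilin m (fun k => a k - a' k) b k = bilin m a b k - bilin m a' b k := by
  rw [bilin, bilin, bilin, ← (summable_bilin_term hm ha hb k).of_norm.tsum_sub
    (summable_bilin_term hm ha' hb k).of_norm]
  exact tsum_congr fun j => by ring

lemma bilin_sub_right (hm : ∀ j l, ‖m j l‖ ≤ C * freqNorm j * freqNorm l)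
    (ha : Summable fun k => freqNorm k * ‖a k‖) (hb : Summable fun k => freqNorm k * ‖b k‖)
    (hb' : Summable fun k => freqNorm k * ‖b' k‖) (k : Fin d → ℤ) :
    bilin m a (fun k => b k - b' k) k = bilin m a b k - bilin m a b' k := by
  rw [bilin, bilin, bilin, ← (summable_bilin_term hm ha hb k).of_norm.tsum_sub
    (summable_bilin_term hm ha hb' k).of_norm]
  exact tsum_congr fun j => by ring

/-- A Hermitian kernel preserves the symmetry of the Fourier coefficients of real functions. -/
lemma bilin_neg (hm : ∀ j l, m (-j) (-l) = (starRingEnd ℂ) (m j l))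
    (ha : ∀ k, a (-k) = (starRingEnd ℂ) (a k)) (hb : ∀ k, b (-k) = (starRingEnd ℂ) (b k))
    (k : Fin d → ℤ) : bilin m a b (-k) = (starRingEnd ℂ) (bilin m a b k) := by
  rw [bilin, bilin, Complex.conj_tsum, ← (Equiv.neg _).tsum_eq]
  refine tsum_congr fun j => ?_
  simp only [Equiv.neg_apply, map_mul, ← ha, ← hb, ← hm]
  rw [show -k - -j = -(k - j) by abel]

/-- The weight `exp (ρ |k|)` is submultiplicative, so a bilinear term inherits the decay of its
arguments up to one derivative on each of them. -/
lemma norm_bilin_le_of_weight (hC : 0 ≤ C)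
    (hm : ∀ j l, ‖m j l‖ ≤ C * freqNorm j * freqNorm l) {α β : (Fin d → ℤ) → ℝ} {ρ : ℝ}
    (hρ : 0 ≤ ρ) (hα : Summable α) (hβ : Summable β)
    (ha : ∀ k, freqNorm k * ‖a k‖ ≤ α k * Real.exp (-ρ * freqNorm k))
    (hb : ∀ k, freqNorm k * ‖b k‖ ≤ β k * Real.exp (-ρ * freqNorm k)) (k : Fin d → ℤ) :
    ‖bilin m a b k‖ ≤ C * (∑' j, α j * β (k - j)) * Real.exp (-ρ * freqNorm k) := by
  have hα0 : ∀ k, 0 ≤ α k := fun k => nonneg_of_mul_nonneg_left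
    ((mul_nonneg (freqNorm_nonneg k) (norm_nonneg _)).trans (ha k)) (Real.exp_pos _)
  have hβ0 : ∀ k, 0 ≤ β k := fun k => nonneg_of_mul_nonneg_left
    ((mul_nonneg (freqNorm_nonneg k) (norm_nonneg _)).trans (hb k)) (Real.exp_pos _)
  have hs := (summable_conv hα0 hβ0 hα hβ k).mul_left (C * Real.exp (-ρ * freqNorm k))
  refine (tsum_of_norm_bounded hs.hasSum fun j => ?_).trans (le_of_eq ?_)
  · refine (norm_bilin_term_le hm k j).trans ?_
    have h1 := mul_le_mul (ha j) (hb (k - j))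
      (mul_nonneg (freqNorm_nonneg _) (norm_nonneg _))
      (mul_nonneg (hα0 j) (Real.exp_pos _).le)
    have h2 : Real.exp (-ρ * freqNorm j) * Real.exp (-ρ * freqNorm (k - j))
        ≤ Real.exp (-ρ * freqNorm k) := by
      rw [← Real.exp_add, Real.exp_le_exp]
      nlinarith [freqNorm_le_add_sub k j]
    calc _ ≤ C * ((α j * Real.exp (-ρ * freqNorm j))
          * (β (k - j) * Real.exp (-ρ * freqNorm (k - j)))) := by gcongr
      _ = C * (α j * β (k - j)) * (Real.exp (-ρ * freqNorm j)
          * Real.exp (-ρ * freqNorm (k - j))) := by ring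
      _ ≤ C * (α j * β (k - j)) * Real.exp (-ρ * freqNorm k) := by
          have := mul_nonneg hC (mul_nonneg (hα0 j) (hβ0 (k - j)))
          gcongr
      _ = _ := by ring
  · rw [tsum_mul_left]; ring

end Bilin

/-! ### The right-hand side of the equation as a Fourier series -/

/-- Coefficients with Hermitian symmetry sum to a real function. -/
lemma hasSum_re_of_conj {c : (Fin d → ℤ) → ℂ} (hs : Summable fun k => ‖c k‖)
    (hc : ∀ k, c (-k) = (starRingEnd ℂ) (c k)) (x : Fin d → ℝ) :
    HasSum (fun k => c k * character k x) (((∑' k, c k * character k x).re : ℝ) : ℂ) := by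
  have hsum : Summable fun k => c k * character k x := by
    refine Summable.of_norm (hs.congr fun k => ?_)
    rw [norm_mul, norm_character, mul_one]
  have hreal : (starRingEnd ℂ) (∑' k, c k * character k x) = ∑' k, c k * character k x := by
    rw [Complex.conj_tsum, ← (Equiv.neg (Fin d → ℤ)).tsum_eq]
    refine tsum_congr fun k => ?_
    simp only [Equiv.neg_apply, map_mul, hc, character_neg, Complex.conj_conj]
  rw [Complex.conj_eq_iff_re.mp hreal]
  exact hsum.hasSum

/-- A Fourier multiplier with Hermitian symbol, applied to a real function, gives a series with
real sum: taking the real part in `fourierMultiplier` is harmless. -/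
lemma hasSum_fourierMultiplier {m : (Fin d → ℤ) → ℂ} {f : (Fin d → ℝ) → ℝ}
    (hm : ∀ k, m (-k) = (starRingEnd ℂ) (m k))
    (hs : Summable fun k => ‖m k * fourierCoefficient f k‖) (x : Fin d → ℝ) :
    HasSum (fun k => m k * fourierCoefficient f k * character k x)
      (fourierMultiplier m f x : ℂ) :=
  hasSum_re_of_conj hs (fun k => by rw [hm, fourierCoefficient_neg, map_mul]) x

/-- The linear form `v ↦ k · v`. -/
noncomputable def freqForm (k : Fin d → ℤ) : (Fin d → ℝ) →L[ℝ] ℝ :=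
  ∑ i, (k i : ℝ) • ContinuousLinearMap.proj i

lemma freqForm_apply (k : Fin d → ℤ) (v : Fin d → ℝ) :
    freqForm k v = ∑ i, (k i : ℝ) * v i := by
  simp [freqForm]

lemma norm_freqForm_le (k : Fin d → ℤ) : ‖freqForm k‖ ≤ d * freqNorm k := by
  refine ContinuousLinearMap.opNorm_le_bound _ (by positivity [freqNorm_nonneg k]) fun v => ?_
  rw [freqForm_apply]
  refine (norm_sum_le _ _).trans ?_
  calc ∑ i, ‖(k i : ℝ) * v i‖ ≤ ∑ _i : Fin d, freqNorm k * ‖v‖ := by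
        refine Finset.sum_le_sum fun i _ => ?_
        rw [norm_mul]
        exact mul_le_mul (abs_coord_le_freqNorm k i) (norm_le_pi_norm v i) (norm_nonneg _)
          (freqNorm_nonneg k)
    _ = _ := by simp; ring

lemma hasFDerivAt_character (k : Fin d → ℤ) (x : Fin d → ℝ) :
    HasFDerivAt (character k)
      ((character k x * Complex.I) • Complex.ofRealCLM.comp (freqForm k)) x := by
  have h1 : HasFDerivAt (fun x : Fin d → ℝ => ((∑ i, (k i : ℝ) * x i : ℝ) : ℂ))
      (Complex.ofRealCLM.comp (freqForm k)) x := by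
    have := (Complex.ofRealCLM.comp (freqForm k)).hasFDerivAt (x := x)
    refine this.congr_of_eventuallyEq (Eventually.of_forall fun y => ?_)
    simp [freqForm_apply]
  have h2 := (h1.const_mul Complex.I).cexp
  refine h2.congr_fderiv ?_
  rw [smul_smul]
  rfl

/-- Termwise differentiation of a rapidly convergent Fourier series of a real function. -/
lemma hasSum_fderiv {f : (Fin d → ℝ) → ℝ} {c : (Fin d → ℤ) → ℂ}
    (hc : Summable fun k => ‖c k‖) (hc1 : Summable fun k => freqNorm k * ‖c k‖)
    (hf : ∀ x, HasSum (fun k => c k * character k x) (f x : ℂ)) (q : Fin d) (x : Fin d → ℝ) :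
    HasSum (fun k => Complex.I * (k q : ℂ) * c k * character k x)
      (fderiv ℝ f x (Pi.single q 1) : ℂ) := by
  let D : (Fin d → ℤ) → (Fin d → ℝ) → (Fin d → ℝ) →L[ℝ] ℂ := fun k x =>
    c k • ((character k x * Complex.I) • Complex.ofRealCLM.comp (freqForm k))
  have hu : Summable fun k : Fin d → ℤ => d * (freqNorm k * ‖c k‖) := hc1.mul_left _
  have hD : ∀ k x, ‖D k x‖ ≤ d * (freqNorm k * ‖c k‖) := by
    intro k x
    rw [norm_smul, norm_smul, norm_mul, norm_character, Complex.norm_I, one_mul, one_mul]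
    have h1 : ‖Complex.ofRealCLM.comp (freqForm k)‖ ≤ d * freqNorm k :=
      (ContinuousLinearMap.opNorm_comp_le _ _).trans
        (by rw [Complex.ofRealCLM_norm, one_mul]; exact norm_freqForm_le k)
    calc _ ≤ ‖c k‖ * (d * freqNorm k) := by gcongr
      _ = _ := by ring
  have hG := hasFDerivAt_tsum hu (fun k y => (hasFDerivAt_character k y).const_mul (c k)) hD
    (x₀ := 0) (by
      refine Summable.of_norm (hc.congr fun k => ?_)
      rw [norm_mul, norm_character, mul_one]) x
  have hGf : (fun y => ∑' k, c k * character k y) = fun y => (f y : ℂ) :=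
    funext fun y => (hf y).tsum_eq
  rw [hGf] at hG
  have hfd : HasFDerivAt f (Complex.reCLM.comp (∑' k, D k x)) x :=
    (Complex.reCLM.hasFDerivAt.comp x hG)
  have huniq := hG.unique (Complex.ofRealCLM.hasFDerivAt.comp x hfd)
  have hval : (fderiv ℝ f x (Pi.single q 1) : ℂ) = (∑' k, D k x) (Pi.single q 1) := by
    rw [hfd.fderiv]
    exact (congrArg (fun L => L (Pi.single q 1)) huniq).symm
  have hDs : Summable fun k => D k x := Summable.of_norm_bounded hu fun k => hD k x
  rw [hval]
  have := (ContinuousLinearMap.apply ℝ ℂ (Pi.single q (1 : ℝ) : Fin d → ℝ)).hasSum hDs.hasSum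
  convert! this using 1
  funext k
  have h1 : freqForm k (Pi.single q 1) = (k q : ℝ) := by
    simp [freqForm_apply, Pi.single_apply]
  simp only [D, ContinuousLinearMap.apply_apply, smul_apply, ContinuousLinearMap.comp_apply, h1,
    smul_eq_mul, Complex.ofRealCLM_apply, Complex.ofReal_intCast]
  ring

/-- The Fourier coefficients of `S - κ Λ^γ f - u[f] · ∇f`, in terms of those of `S` and `f`. -/
noncomputable def rhsCoeff (κ γ : ℝ) (T : Fin d → Fin d → (Fin d → ℤ) → ℂ)
    (s c : (Fin d → ℤ) → ℂ) (k : Fin d → ℤ) : ℂ :=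
  s k - (κ * freqNorm k ^ γ : ℝ) * c k - bilin (transportKernel T) c c k

/-- The product of two Fourier series, one hit by the drift and the other by the gradient. -/
lemma hasSum_transport {C₀ : ℝ} {T : Fin d → Fin d → (Fin d → ℤ) → ℂ}
    (hC₀ : 0 ≤ C₀) (hT : AdmissibleSymbol C₀ T)
    {f : (Fin d → ℝ) → ℝ} (hc1 : Summable fun k => freqNorm k * ‖fourierCoefficient f k‖)
    (hc : Summable fun k => ‖fourierCoefficient f k‖)
    (hf : ∀ x, HasSum (fun k => fourierCoefficient f k * character k x) (f x : ℂ))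
    (x : Fin d → ℝ) :
    HasSum (fun k => bilin (transportKernel T) (fourierCoefficient f) (fourierCoefficient f) k
        * character k x)
      ((∑ j, velocity T f j x * fderiv ℝ f x (Pi.single j 1) : ℝ) : ℂ) := by
  set c := fourierCoefficient f with hcdef
  have hnd : ∀ q : Fin d, Summable fun k => ‖driftSymbol T q k * c k‖ := fun q =>
    Summable.of_nonneg_of_le (fun _ => norm_nonneg _) (fun k => by
      rw [norm_mul]
      calc _ ≤ (C₀ * d * freqNorm k) * ‖c k‖ := by
            gcongr; exact norm_driftSymbol_le hT q k
        _ = C₀ * d * (freqNorm k * ‖c k‖) := by ring) (hc1.mul_left (C₀ * d))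
  have hnl : ∀ q : Fin d, Summable fun k => ‖Complex.I * (k q : ℂ) * c k * character k x‖ :=
    fun q => Summable.of_nonneg_of_le (fun _ => norm_nonneg _) (fun k => by
      rw [norm_mul, norm_mul, norm_mul, norm_character, Complex.norm_I, one_mul, mul_one]
      have h1 : ‖(k q : ℂ)‖ = |(k q : ℝ)| := by simp
      rw [h1]
      gcongr
      exact abs_coord_le_freqNorm k q) hc1
  have hv : ∀ q, HasSum (fun k => driftSymbol T q k * c k * character k x)
      (velocity T f q x : ℂ) := fun q =>
    hasSum_fourierMultiplier (fun k => driftSymbol_neg hT q k) (hnd q) x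
  have hg : ∀ q, HasSum (fun k => Complex.I * (k q : ℂ) * c k * character k x)
      (fderiv ℝ f x (Pi.single q 1) : ℂ) := fun q => hasSum_fderiv hc hc1 hf q x
  have hprod : ∀ q ∈ Finset.univ, HasSum (fun p : (Fin d → ℤ) × (Fin d → ℤ) =>
      (driftSymbol T q p.2 * c p.2 * character p.2 x)
        * (Complex.I * ((p.1 - p.2) q : ℂ) * c (p.1 - p.2) * character (p.1 - p.2) x))
      ((velocity T f q x : ℂ) * (fderiv ℝ f x (Pi.single q 1) : ℂ)) := fun q _ => by
    have hn : Summable fun k => ‖driftSymbol T q k * c k * character k x‖ :=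
      (hnd q).congr fun k => by rw [norm_mul _ (character k x), norm_character, mul_one]
    have h := hasSum_conv_of_norm (hv q) (hg q) hn (hnl q)
    exact h
  have hsum2 := hasSum_sum hprod
  have key := hsum2.prod_fiberwise (g := fun k => bilin (transportKernel T) c c k * character k x)
    (fun k => by
      have h1 := (summable_bilin_term (norm_transportKernel_le hC₀ hT) hc1 hc1 k).of_norm.hasSum
      convert! h1.mul_right (character k x) using 1
      funext j
      have hch : character k x = character j x * character (k - j) x := by
        rw [← character_add]; congr 1; abel
      simp only [transportKernel, Finset.sum_mul, hch]
      exact Finset.sum_congr rfl fun q _ => by ring)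
  push_cast
  exact key

/-- A summable majorant of `rhsCoeff`, uniform over all sequences with a given exponential decay. -/
lemma exists_rhsCoeff_majorant {C₀ : ℝ} {T : Fin d → Fin d → (Fin d → ℤ) → ℂ}
    (hC₀ : 0 ≤ C₀) (hT : AdmissibleSymbol C₀ T) (κ γ : ℝ) {s : (Fin d → ℤ) → ℂ}
    (hs : Summable fun k => ‖s k‖) {M σ : ℝ} (hM : 0 ≤ M) (hσ : 0 < σ) :
    ∃ G : (Fin d → ℤ) → ℝ, Summable G ∧ ∀ c : (Fin d → ℤ) → ℂ,
      (∀ k, ‖c k‖ ≤ M * Real.exp (-σ * freqNorm k)) → ∀ k, ‖rhsCoeff κ γ T s c k‖ ≤ G k := by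
  have hd0 : ∀ k : Fin d → ℤ, 0 ≤ M * Real.exp (-σ * freqNorm k) := fun k => by positivity
  have h1 := summable_freqNorm_mul_of_decay hσ hd0 fun _ => le_rfl
  have hγ := summable_rpow_mul_of_decay hσ hd0 (fun _ => le_rfl) γ
  have h10 : ∀ k : Fin d → ℤ, 0 ≤ freqNorm k * (M * Real.exp (-σ * freqNorm k)) := fun k =>
    mul_nonneg (freqNorm_nonneg k) (hd0 k)
  refine ⟨_, (hs.add (hγ.mul_left |κ|)).add
    ((hasSum_conv h10 h10 h1 h1).summable.mul_left (C₀ * d ^ 2)), fun c hc k => ?_⟩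
  rw [rhsCoeff]
  refine (norm_sub_le _ _).trans
    (add_le_add ((norm_sub_le _ _).trans (add_le_add le_rfl ?_)) ?_)
  · rw [norm_mul, Complex.norm_real, Real.norm_eq_abs, abs_mul,
      abs_of_nonneg (Real.rpow_nonneg (freqNorm_nonneg k) γ), mul_assoc]
    have := Real.rpow_nonneg (freqNorm_nonneg k) γ
    gcongr
    exact hc k
  · have hck : ∀ k, freqNorm k * ‖c k‖
        ≤ freqNorm k * (M * Real.exp (-σ * freqNorm k)) * Real.exp (-0 * freqNorm k) := by
      intro k
      simpa using mul_le_mul_of_nonneg_left (hc k) (freqNorm_nonneg k)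
    simpa using norm_bilin_le_of_weight (by positivity) (norm_transportKernel_le hC₀ hT)
      le_rfl h1 h1 hck hck k

/-- The right-hand side of the equation is the Fourier series with coefficients `rhsCoeff`. -/
lemma hasSum_rhs {C₀ : ℝ} {T : Fin d → Fin d → (Fin d → ℤ) → ℂ}
    (hC₀ : 0 ≤ C₀) (hT : AdmissibleSymbol C₀ T) (κ γ : ℝ)
    {f S : (Fin d → ℝ) → ℝ} {c s : (Fin d → ℤ) → ℂ}
    (hS : ∀ x, HasSum (fun k => s k * character k x) (S x : ℂ))
    {M σ : ℝ} (hσ : 0 < σ) (hc : ∀ k, ‖c k‖ ≤ M * Real.exp (-σ * freqNorm k))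
    (hf : ∀ x, HasSum (fun k => c k * character k x) (f x : ℂ)) (x : Fin d → ℝ) :
    HasSum (fun k => rhsCoeff κ γ T s c k * character k x)
      ((S x - κ * fracLaplacian γ f x
        - ∑ j, velocity T f j x * fderiv ℝ f x (Pi.single j 1) : ℝ) : ℂ) := by
  have hc0 := summable_of_decay hσ (fun k => norm_nonneg (c k)) hc
  have hfc : fourierCoefficient f = c := funext (fourierCoefficient_of_hasSum hc0 hf)
  subst hfc
  have hc1 := summable_freqNorm_mul_of_decay hσ (fun k => norm_nonneg _) hc
  have hcγ := summable_rpow_mul_of_decay hσ (fun k => norm_nonneg _) hc γ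
  have h1 : HasSum (fun k => ((freqNorm k ^ γ : ℝ) : ℂ) * fourierCoefficient f k * character k x)
      (fracLaplacian γ f x : ℂ) := by
    refine hasSum_fourierMultiplier (fun k => by simp) (hcγ.congr fun k => ?_) x
    rw [norm_mul, Complex.norm_real, Real.norm_of_nonneg (Real.rpow_nonneg (freqNorm_nonneg k) γ)]
  have h2 := hasSum_transport hC₀ hT hc1 hc0 hf x
  have h3 := ((hS x).sub (h1.mul_left (κ : ℂ))).sub h2
  rw [Complex.ofReal_sub, Complex.ofReal_sub, Complex.ofReal_mul]
  convert! h3 using 1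
  funext k
  rw [rhsCoeff]
  push_cast
  ring

/-! ### A fixed point theorem for quadratic maps -/

/-- Contraction mapping principle for `v ↦ L + Q(v, v)` with `Q` bilinear and small compared to
`L`, keeping track of a closed invariant set `P`. -/
lemma exists_fixedPoint_quadratic {E : Type*} [NormedAddCommGroup E] [CompleteSpace E]
    {Q : E → E → E} {L : E} {η A : ℝ} {P : Set E} (hη : 0 ≤ η)
    (hQ : ∀ v w, ‖Q v w‖ ≤ η * ‖v‖ * ‖w‖) (hl : ∀ v v' w, Q (v - v') w = Q v w - Q v' w)
    (hr : ∀ v w w', Q v (w - w') = Q v w - Q v w') (hL : ‖L‖ ≤ A) (hA : 4 * η * A < 1)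
    (hPc : IsClosed P) (hP0 : 0 ∈ P) (hP : ∀ v ∈ P, L + Q v v ∈ P) :
    ∃ v ∈ P, L + Q v v = v := by
  have hA0 : 0 ≤ A := (norm_nonneg L).trans hL
  let s : Set E := Metric.closedBall 0 (2 * A) ∩ P
  have hs : ∀ v ∈ s, ‖v‖ ≤ 2 * A := fun v hv => by simpa using hv.1
  have hmaps : MapsTo (fun v => L + Q v v) s s := by
    intro v hv
    refine ⟨?_, hP v hv.2⟩
    rw [mem_closedBall_zero_iff]
    have h := hs v hv
    calc ‖L + Q v v‖ ≤ A + η * ‖v‖ * ‖v‖ := (norm_add_le _ _).trans (add_le_add hL (hQ v v))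
      _ ≤ A + η * (2 * A) * (2 * A) := by gcongr
      _ ≤ 2 * A := by nlinarith
  have hcontr : ContractingWith ⟨4 * η * A, by positivity⟩ (hmaps.restrict _ s s) := by
    refine ⟨by exact_mod_cast hA, LipschitzWith.of_dist_le_mul fun v w => ?_⟩
    obtain ⟨v, hv⟩ := v
    obtain ⟨w, hw⟩ := w
    rw [Subtype.dist_eq, Subtype.dist_eq, dist_eq_norm, dist_eq_norm]
    change ‖(L + Q v v) - (L + Q w w)‖ ≤ 4 * η * A * ‖v - w‖
    have h : (L + Q v v) - (L + Q w w) = Q (v - w) v + Q w (v - w) := by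
      rw [hl, hr]; abel
    rw [h]
    have h1 := hs v hv
    have h2 := hs w hw
    calc ‖Q (v - w) v + Q w (v - w)‖ ≤ η * ‖v - w‖ * ‖v‖ + η * ‖w‖ * ‖v - w‖ :=
          (norm_add_le _ _).trans (add_le_add (hQ _ _) (hQ _ _))
      _ ≤ η * ‖v - w‖ * (2 * A) + η * (2 * A) * ‖v - w‖ := by gcongr
      _ = 4 * η * A * ‖v - w‖ := by ring
  have hsc : IsComplete s := (Metric.isClosed_closedBall.inter hPc).isComplete
  obtain ⟨v, hvs, hfix, -⟩ := hcontr.exists_fixedPoint' hsc hmaps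
    (x := 0) ⟨by simpa using hA0, hP0⟩ (edist_ne_top _ _)
  exact ⟨v, hvs.2, hfix⟩

/-! ### The space of time-dependent Fourier coefficients -/

/-- Time clamped to `[0, T]`, so that coefficients can be functions on the whole line. -/
def clamp (T t : ℝ) : ℝ := max 0 (min t T)

lemma clamp_nonneg (T t : ℝ) : 0 ≤ clamp T t := le_max_left _ _

lemma clamp_le {T : ℝ} (hT : 0 ≤ T) (t : ℝ) : clamp T t ≤ T := max_le hT (min_le_right _ _)

lemma clamp_of_mem {T t : ℝ} (h0 : 0 ≤ t) (ht : t ≤ T) : clamp T t = t := by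
  rw [clamp, min_eq_left ht, max_eq_right h0]

@[fun_prop]
lemma continuous_clamp (T : ℝ) : Continuous (clamp T) := by
  unfold clamp; fun_prop

/-- The radius of analyticity `τ - lam t`, shrinking linearly on `[0, T]` and then frozen. -/
def shrinkingRadius (τ lam T t : ℝ) : ℝ := τ - lam * clamp T t

@[fun_prop]
lemma continuous_shrinkingRadius (τ lam T : ℝ) : Continuous (shrinkingRadius τ lam T) := by
  unfold shrinkingRadius; fun_prop

/-- `ℓ¹` sequences, indexed by frequencies, of bounded continuous functions of time. A coefficient
sequence `a` is represented by `v k t = |k| exp (ρ(t) |k|) a t k`. The supremum in time is taken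
inside the sum over frequencies: this is what makes the time integral gain a derivative. -/
abbrev CoeffSpace (d : ℕ) : Type := lp (fun _ : Fin d → ℤ => ℝ →ᵇ ℂ) 1

lemma CoeffSpace.hasSum_norm (v : CoeffSpace d) : HasSum (fun k => ‖v k‖) ‖v‖ := by
  simpa using lp.hasSum_norm (p := 1) (by simp) v

lemma exists_coeffSpace {F : (Fin d → ℤ) → ℝ → ℂ} (hF : ∀ k, Continuous (F k))
    {β : (Fin d → ℤ) → ℝ} (hβ : Summable β) (hFβ : ∀ k t, ‖F k t‖ ≤ β k) :
    ∃ v : CoeffSpace d, (∀ k t, v k t = F k t) ∧ ‖v‖ ≤ ∑' k, β k := by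
  have hβ0 : ∀ k, 0 ≤ β k := fun k => (norm_nonneg _).trans (hFβ k 0)
  let G : (Fin d → ℤ) → ℝ →ᵇ ℂ := fun k =>
    BoundedContinuousFunction.ofNormedAddCommGroup (F k) (hF k) (β k) (hFβ k)
  have hG : ∀ k, ‖G k‖ ≤ β k := fun k =>
    BoundedContinuousFunction.norm_ofNormedAddCommGroup_le (hF k) (hβ0 k) (hFβ k)
  have hmem : Memℓp G 1 := memℓp_gen (by
    simpa using Summable.of_nonneg_of_le (fun k => norm_nonneg (G k)) hG hβ)
  let v : CoeffSpace d := ⟨G, hmem⟩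
  refine ⟨v, fun k t => rfl, ?_⟩
  rw [← (CoeffSpace.hasSum_norm v).tsum_eq]
  exact (CoeffSpace.hasSum_norm v).summable.tsum_le_tsum hG hβ

/-- The coefficient sequence represented by `v`. The zero mode vanishes because `|0|⁻¹ = 0`. -/
noncomputable def unweight (ρ : ℝ → ℝ) (v : CoeffSpace d) (t : ℝ) (k : Fin d → ℤ) : ℂ :=
  v k t * ((Real.exp (-ρ t * freqNorm k) / freqNorm k : ℝ) : ℂ)

lemma unweight_zero (ρ : ℝ → ℝ) (v : CoeffSpace d) (t : ℝ) : unweight ρ v t 0 = 0 := by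
  simp [unweight]

lemma continuous_unweight {ρ : ℝ → ℝ} (hρ : Continuous ρ) (v : CoeffSpace d) (k : Fin d → ℤ) :
    Continuous fun t => unweight ρ v t k := by
  unfold unweight
  have := (v k).continuous
  fun_prop

lemma freqNorm_mul_norm_unweight_le (ρ : ℝ → ℝ) (v : CoeffSpace d) (t : ℝ) (k : Fin d → ℤ) :
    freqNorm k * ‖unweight ρ v t k‖ ≤ ‖v k‖ * Real.exp (-ρ t * freqNorm k) := by
  by_cases hk : k = 0
  · simp [hk]
  have hk' := freqNorm_pos hk
  rw [unweight, norm_mul, Complex.norm_real, Real.norm_of_nonneg (by positivity)]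
  calc _ = ‖v k t‖ * Real.exp (-ρ t * freqNorm k) := by field_simp
    _ ≤ _ := by
        have := (v k).norm_coe_le_norm t
        gcongr

lemma unweight_sub (ρ : ℝ → ℝ) (v w : CoeffSpace d) (t : ℝ) :
    unweight ρ (v - w) t = fun k => unweight ρ v t k - unweight ρ w t k := by
  funext k
  simp [unweight, sub_mul]

lemma summable_unweight {ρ : ℝ → ℝ} {t : ℝ} (hρ : 0 ≤ ρ t) (v : CoeffSpace d) :
    Summable fun k => freqNorm k * ‖unweight ρ v t k‖ := by
  refine Summable.of_nonneg_of_le (fun k => mul_nonneg (freqNorm_nonneg k) (norm_nonneg _))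
    (fun k => (freqNorm_mul_norm_unweight_le ρ v t k).trans ?_)
    (CoeffSpace.hasSum_norm v).summable
  refine mul_le_of_le_one_right (norm_nonneg _) (Real.exp_le_one_iff.mpr ?_)
  nlinarith [freqNorm_nonneg k]

/-! ### The Duhamel operator -/

/-- The weighted solution operator `h ↦ |k| exp (ρ(t)|k|) ∫₀ᵗ exp (-μ (t - s)) h(s) ds`. -/
noncomputable def duhamel (τ lam T : ℝ) (μ N : ℝ) (h : ℝ → ℂ) (t : ℝ) : ℂ :=
  ((N * Real.exp (shrinkingRadius τ lam T t * N - μ * clamp T t) : ℝ) : ℂ)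
    * ∫ s in (0 : ℝ)..clamp T t, (Real.exp (μ * s) : ℂ) * h s

lemma continuous_duhamel (τ lam T μ N : ℝ) {h : ℝ → ℂ} (hh : Continuous h) :
    Continuous (duhamel τ lam T μ N h) := by
  unfold duhamel
  have h1 : Continuous fun s : ℝ => (Real.exp (μ * s) : ℂ) * h s := by fun_prop
  have h2 : Continuous fun t : ℝ => ∫ s in (0 : ℝ)..t, (Real.exp (μ * s) : ℂ) * h s :=
    intervalIntegral.continuous_primitive (fun a b => h1.intervalIntegrable a b) 0
  have h3 := h2.comp (continuous_clamp T)
  simp only [Function.comp_def] at h3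
  fun_prop

/-- The loss of analyticity radius at rate `lam` pays for one derivative: the factor `N = |k|` is
absorbed by `∫₀ᵗ exp (-lam (t - s) N) ds ≤ 1 / (lam N)`. -/
lemma norm_duhamel_le {τ lam T μ N D : ℝ} (hlam : 0 < lam) (hT : 0 ≤ T) (hμ : 0 ≤ μ) (hN : 0 ≤ N)
    (hD : 0 ≤ D) {h : ℝ → ℂ}
    (hh : ∀ s, ‖h s‖ ≤ D * Real.exp (-shrinkingRadius τ lam T s * N)) (t : ℝ) :
    ‖duhamel τ lam T μ N h t‖ ≤ D / lam := by
  rcases hN.eq_or_lt with rfl | hN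
  · simp only [duhamel, zero_mul, Complex.ofReal_zero, norm_zero]; positivity
  set c := clamp T t with hc
  have hc0 : 0 ≤ c := clamp_nonneg T t
  have hcT : c ≤ T := clamp_le hT t
  have hint : ‖∫ s in (0 : ℝ)..c, (Real.exp (μ * s) : ℂ) * h s‖
      ≤ ∫ s in (0 : ℝ)..c, Real.exp (μ * c) * D * Real.exp (-τ * N) * Real.exp (lam * N * s) := by
    refine intervalIntegral.norm_integral_le_of_norm_le hc0 ?_
      (Continuous.intervalIntegrable (by fun_prop) _ _)
    refine Eventually.of_forall fun s hs => ?_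
    have h1 := hh s
    rw [shrinkingRadius, clamp_of_mem hs.1.le (hs.2.trans hcT)] at h1
    rw [norm_mul, Complex.norm_real, Real.norm_of_nonneg (Real.exp_pos _).le]
    have h2 : Real.exp (μ * s) ≤ Real.exp (μ * c) := by
      rw [Real.exp_le_exp]; exact mul_le_mul_of_nonneg_left hs.2 hμ
    calc _ ≤ Real.exp (μ * c) * (D * Real.exp (-(τ - lam * s) * N)) := by gcongr
      _ = Real.exp (μ * c) * D * (Real.exp (-τ * N) * Real.exp (lam * N * s)) := by
          rw [← Real.exp_add, mul_assoc]; ring_nf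
      _ = _ := by ring
  have hval : ∫ s in (0 : ℝ)..c, Real.exp (lam * N * s) ≤ Real.exp (lam * N * c) / (lam * N) := by
    have hne : lam * N ≠ 0 := by positivity
    rw [intervalIntegral.integral_comp_mul_left (fun y => Real.exp y) hne, integral_exp,
      smul_eq_mul, mul_zero, Real.exp_zero, inv_mul_eq_div]
    gcongr
    linarith
  rw [intervalIntegral.integral_const_mul] at hint
  rw [duhamel, norm_mul, Complex.norm_real, Real.norm_of_nonneg (by positivity)]
  calc _ ≤ (N * Real.exp (shrinkingRadius τ lam T t * N - μ * c))
        * (Real.exp (μ * c) * D * Real.exp (-τ * N) * (Real.exp (lam * N * c) / (lam * N))) := by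
        gcongr
        exact hint.trans (by gcongr)
    _ = D / lam * (Real.exp (shrinkingRadius τ lam T t * N - μ * c) * Real.exp (μ * c)
        * Real.exp (-τ * N) * Real.exp (lam * N * c)) := by field_simp
    _ = D / lam := by
        rw [← Real.exp_add, ← Real.exp_add, ← Real.exp_add, shrinkingRadius, ← hc]
        ring_nf
        simp

lemma duhamel_conj {τ lam T μ N : ℝ} {h h' : ℝ → ℂ}
    (hh : ∀ s, h' s = (starRingEnd ℂ) (h s)) (t : ℝ) :
    duhamel τ lam T μ N h' t = (starRingEnd ℂ) (duhamel τ lam T μ N h t) := by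
  rw [duhamel, duhamel, map_mul, Complex.conj_ofReal, intervalIntegral, intervalIntegral, map_sub,
    ← integral_conj, ← integral_conj]
  simp only [hh, map_mul, Complex.conj_ofReal]

lemma duhamel_sub {τ lam T μ N : ℝ} {h h' : ℝ → ℂ} (hh : Continuous h) (hh' : Continuous h')
    (t : ℝ) :
    duhamel τ lam T μ N (fun s => h s - h' s) t
      = duhamel τ lam T μ N h t - duhamel τ lam T μ N h' t := by
  rw [duhamel, duhamel, duhamel, ← mul_sub, ← intervalIntegral.integral_sub
    (Continuous.intervalIntegrable (by fun_prop) _ _)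
    (Continuous.intervalIntegrable (by fun_prop) _ _)]
  simp only [mul_sub]

/-! ### Solving the Fourier-side system -/

section Existence

variable {m : (Fin d → ℤ) → (Fin d → ℤ) → ℂ} {C : ℝ}

lemma continuous_bilin (hm : ∀ j l, ‖m j l‖ ≤ C * freqNorm j * freqNorm l) (hC : 0 ≤ C)
    {a b : ℝ → (Fin d → ℤ) → ℂ} {α β : (Fin d → ℤ) → ℝ}
    (ha : ∀ k, Continuous fun t => a t k) (hb : ∀ k, Continuous fun t => b t k)
    (hα : Summable α) (hβ : Summable β) (haα : ∀ t k, freqNorm k * ‖a t k‖ ≤ α k)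
    (hbβ : ∀ t k, freqNorm k * ‖b t k‖ ≤ β k) (k : Fin d → ℤ) :
    Continuous fun t => bilin m (a t) (b t) k := by
  have hα0 : ∀ k, 0 ≤ α k := fun k =>
    (mul_nonneg (freqNorm_nonneg k) (norm_nonneg _)).trans (haα 0 k)
  have hβ0 : ∀ k, 0 ≤ β k := fun k =>
    (mul_nonneg (freqNorm_nonneg k) (norm_nonneg _)).trans (hbβ 0 k)
  refine continuous_tsum (fun j => ?_) ((summable_conv hα0 hβ0 hα hβ k).mul_left C)
    (fun j t => (norm_bilin_term_le hm k j).trans ?_)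
  · have := ha j
    have := hb (k - j)
    fun_prop
  · refine mul_le_mul_of_nonneg_left (mul_le_mul (haα t j) (hbβ t _) ?_ (hα0 j)) hC
    exact mul_nonneg (freqNorm_nonneg _) (norm_nonneg _)

variable {τ lam : ℝ}

lemma shrinkingRadius_ge (hτ : 0 < τ) (hlam : 0 < lam) (t : ℝ) :
    τ / 2 ≤ shrinkingRadius τ lam (τ / (2 * lam)) t := by
  have h := clamp_le (T := τ / (2 * lam)) (by positivity) t
  have h2 : lam * clamp (τ / (2 * lam)) t ≤ lam * (τ / (2 * lam)) := by gcongr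
  have h3 : lam * (τ / (2 * lam)) = τ / 2 := by field_simp
  rw [shrinkingRadius]
  linarith

/-- Local existence for the system of Fourier coefficients, in integral form. The time of
existence is the time in which the radius `τ - lam t` decreases to `τ / 2`; it does not see the
dissipation rates `μ`. -/
lemma exists_coeff_solution (hC : 0 ≤ C) (hm : ∀ j l, ‖m j l‖ ≤ C * freqNorm j * freqNorm l)
    (hmconj : ∀ j l, m (-j) (-l) = (starRingEnd ℂ) (m j l)) (hm0 : ∀ j, m j (-j) = 0)
    (hτ : 0 < τ) (hlam : 0 < lam) {μ : (Fin d → ℤ) → ℝ} (hμ : ∀ k, 0 ≤ μ k)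
    (hμneg : ∀ k, μ (-k) = μ k) {a₀ s : (Fin d → ℤ) → ℂ} (ha₀0 : a₀ 0 = 0) (hs0 : s 0 = 0)
    (ha₀conj : ∀ k, a₀ (-k) = (starRingEnd ℂ) (a₀ k))
    (hsconj : ∀ k, s (-k) = (starRingEnd ℂ) (s k)) {A : ℝ}
    (ha₀ : Summable fun k => freqNorm k * Real.exp (τ * freqNorm k) * ‖a₀ k‖)
    (hs : Summable fun k => Real.exp (τ * freqNorm k) * ‖s k‖)
    (hA : (∑' k, freqNorm k * Real.exp (τ * freqNorm k) * ‖a₀ k‖)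
      + (∑' k, Real.exp (τ * freqNorm k) * ‖s k‖) / lam ≤ A)
    (hsmall : 4 * (C / lam) * A < 1) :
    ∃ (a : ℝ → (Fin d → ℤ) → ℂ) (M : ℝ), (∀ k, Continuous fun t => a t k) ∧
      (∀ t k, ‖a t k‖ ≤ M * Real.exp (-(τ / 2) * freqNorm k)) ∧ (∀ t, a t 0 = 0) ∧
      (∀ t k, a t (-k) = (starRingEnd ℂ) (a t k)) ∧
      ∀ t, 0 ≤ t → t ≤ τ / (2 * lam) → ∀ k,
        a t k = a₀ k + ∫ y in (0 : ℝ)..t, (s k - μ k * a y k - bilin m (a y) (a y) k) := by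
  set T := τ / (2 * lam) with hT
  have hT0 : 0 ≤ T := by positivity
  set ρ := shrinkingRadius τ lam T with hρ
  have hρc : Continuous ρ := continuous_shrinkingRadius _ _ _
  have hρτ : ∀ t, τ / 2 ≤ ρ t := shrinkingRadius_ge hτ hlam
  have hρ0 : ∀ t, 0 ≤ ρ t := fun t => (by positivity : (0 : ℝ) ≤ τ / 2).trans (hρτ t)
  have hρle : ∀ t, ρ t ≤ τ := fun t => by
    have := mul_nonneg hlam.le (clamp_nonneg T t)
    rw [hρ, shrinkingRadius]; linarith
  have hbc : ∀ (v w : CoeffSpace d) k,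
      Continuous fun t => bilin m (unweight ρ v t) (unweight ρ w t) k := by
    intro v w k
    have hle : ∀ (v : CoeffSpace d) t k, freqNorm k * ‖unweight ρ v t k‖ ≤ ‖v k‖ := by
      intro v t k
      refine (freqNorm_mul_norm_unweight_le ρ v t k).trans ?_
      refine mul_le_of_le_one_right (norm_nonneg _) (Real.exp_le_one_iff.mpr ?_)
      nlinarith [freqNorm_nonneg k, hρ0 t]
    exact continuous_bilin hm hC (continuous_unweight hρc v) (continuous_unweight hρc w)
      (CoeffSpace.hasSum_norm v).summable (CoeffSpace.hasSum_norm w).summable (hle v) (hle w) k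
  have hbn : ∀ (v w : CoeffSpace d) k,
      Continuous fun t => -bilin m (unweight ρ v t) (unweight ρ w t) k := fun v w k =>
    (hbc v w k).neg
  -- The quadratic part of the Duhamel formula.
  have hQex : ∀ v w : CoeffSpace d, ∃ q : CoeffSpace d,
      (∀ k t, q k t = duhamel τ lam T (μ k) (freqNorm k)
        (fun y => -bilin m (unweight ρ v y) (unweight ρ w y) k) t) ∧
      ‖q‖ ≤ C / lam * ‖v‖ * ‖w‖ := by
    intro v w
    have hv := CoeffSpace.hasSum_norm v
    have hw := CoeffSpace.hasSum_norm w
    have hconv := hasSum_conv (fun k => norm_nonneg (v k)) (fun k => norm_nonneg (w k))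
      hv.summable hw.summable
    obtain ⟨q, hq, hqn⟩ := exists_coeffSpace
      (F := fun k => duhamel τ lam T (μ k) (freqNorm k)
        (fun y => -bilin m (unweight ρ v y) (unweight ρ w y) k))
      (fun k => continuous_duhamel _ _ _ _ _ (hbn v w k))
      (hconv.summable.mul_left (C / lam)) (fun k t => by
        have hconv0 : 0 ≤ ∑' j, ‖v j‖ * ‖w (k - j)‖ :=
          tsum_nonneg fun j => mul_nonneg (norm_nonneg _) (norm_nonneg _)
        refine (norm_duhamel_le (D := C * ∑' j, ‖v j‖ * ‖w (k - j)‖) hlam hT0 (hμ k)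
          (freqNorm_nonneg k) (by positivity) (fun y => ?_) t).trans (le_of_eq (by ring))
        rw [norm_neg]
        exact norm_bilin_le_of_weight hC hm (hρ0 y) hv.summable hw.summable
          (freqNorm_mul_norm_unweight_le ρ v y) (freqNorm_mul_norm_unweight_le ρ w y) k)
    refine ⟨q, hq, hqn.trans (le_of_eq ?_)⟩
    rw [tsum_mul_left, hconv.tsum_eq, hv.tsum_eq, hw.tsum_eq]; ring
  choose Q hQ hQn using hQex
  -- The contribution of the data.
  obtain ⟨L, hL, hLn⟩ := exists_coeffSpace
    (F := fun k t => ((freqNorm k * Real.exp (ρ t * freqNorm k - μ k * clamp T t) : ℝ) : ℂ) * a₀ k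
      + duhamel τ lam T (μ k) (freqNorm k) (fun _ => s k) t)
    (fun k => by
      have := continuous_duhamel τ lam T (μ k) (freqNorm k) (continuous_const (y := s k))
      fun_prop)
    (ha₀.add (hs.div_const lam)) (fun k t => by
      refine (norm_add_le _ _).trans (add_le_add ?_ ?_)
      · rw [norm_mul, Complex.norm_real, Real.norm_of_nonneg
          (mul_nonneg (freqNorm_nonneg k) (Real.exp_pos _).le)]
        have h1 := mul_nonneg (hμ k) (clamp_nonneg T t)
        have h2 := mul_le_mul_of_nonneg_right (hρle t) (freqNorm_nonneg k)
        have := freqNorm_nonneg k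
        gcongr
        linarith
      · refine norm_duhamel_le hlam hT0 (hμ k) (freqNorm_nonneg k) (by positivity) (fun y => ?_) t
        rw [mul_comm (Real.exp _), mul_assoc, ← Real.exp_add]
        refine le_mul_of_one_le_right (norm_nonneg _) (Real.one_le_exp ?_)
        have h2 := mul_le_mul_of_nonneg_right (hρle y) (freqNorm_nonneg k)
        linarith)
  have hLA : ‖L‖ ≤ A := by
    rw [ha₀.tsum_add (hs.div_const lam), tsum_div_const] at hLn
    exact hLn.trans hA
  -- Hermitian symmetry, the mark of a real function, is a closed condition which the iteration
  -- preserves.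
  let P : Set (CoeffSpace d) := {v | ∀ k t, v (-k) t = (starRingEnd ℂ) (v k t)}
  have heval : ∀ k t, Continuous fun v : CoeffSpace d => v k t := fun k t =>
    (BoundedContinuousFunction.lipschitz_eval_const t).continuous.comp
      (lp.lipschitzWith_one_eval (E := fun _ : Fin d → ℤ => ℝ →ᵇ ℂ) 1 k).continuous
  have hPc : IsClosed P := by
    simp only [P, ofPred_forall]
    exact isClosed_iInter fun k => isClosed_iInter fun t =>
      isClosed_eq (heval _ _) (Complex.continuous_conj.comp (heval _ _))
  have huconj : ∀ v ∈ P, ∀ t k, unweight ρ v t (-k) = (starRingEnd ℂ) (unweight ρ v t k) := by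
    intro v hv t k
    rw [unweight, unweight, hv, map_mul, Complex.conj_ofReal, freqNorm_neg]
  have hbconj : ∀ v ∈ P, ∀ t k, bilin m (unweight ρ v t) (unweight ρ v t) (-k)
      = (starRingEnd ℂ) (bilin m (unweight ρ v t) (unweight ρ v t) k) := by
    exact fun v hv t k => bilin_neg hmconj (huconj v hv t) (huconj v hv t) k
  have hPinv : ∀ v ∈ P, L + Q v v ∈ P := by
    intro v hv k t
    simp only [lp.coeFn_add, Pi.add_apply, BoundedContinuousFunction.add_apply, hL, hQ, map_add,
      map_mul, Complex.conj_ofReal, freqNorm_neg, hμneg, ha₀conj]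
    congr 1
    · congr 1
      exact duhamel_conj (fun _ => hsconj k) t
    · exact duhamel_conj (fun y => by rw [hbconj v hv, map_neg]) t
  obtain ⟨v, hvP, hv⟩ := exists_fixedPoint_quadratic (Q := Q) (L := L) (η := C / lam) (A := A)
    (P := P) (by positivity) hQn
    (fun v v' w => by
      refine lp.ext (funext fun k => BoundedContinuousFunction.ext fun t => ?_)
      simp only [lp.coeFn_sub, Pi.sub_apply, BoundedContinuousFunction.sub_apply, hQ]
      rw [← duhamel_sub (hbn _ _ _) (hbn _ _ _)]
      congr 1
      funext y
      rw [unweight_sub, bilin_sub_left hm (summable_unweight (hρ0 y) v)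
        (summable_unweight (hρ0 y) v') (summable_unweight (hρ0 y) w)]
      ring)
    (fun v w w' => by
      refine lp.ext (funext fun k => BoundedContinuousFunction.ext fun t => ?_)
      simp only [lp.coeFn_sub, Pi.sub_apply, BoundedContinuousFunction.sub_apply, hQ]
      rw [← duhamel_sub (hbn _ _ _) (hbn _ _ _)]
      congr 1
      funext y
      rw [unweight_sub, bilin_sub_right hm (summable_unweight (hρ0 y) v)
        (summable_unweight (hρ0 y) w) (summable_unweight (hρ0 y) w')]
      ring)
    hLA hsmall hPc (fun k t => by simp) hPinv
  refine ⟨unweight ρ v, ‖v‖, continuous_unweight hρc v, fun t k => ?_, unweight_zero ρ v,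
    huconj v hvP, fun t ht0 htT k => ?_⟩
  · by_cases hk : k = 0
    · simp [hk, unweight_zero]
    calc ‖unweight ρ v t k‖ ≤ freqNorm k * ‖unweight ρ v t k‖ :=
          le_mul_of_one_le_left (norm_nonneg _) (one_le_freqNorm hk)
      _ ≤ ‖v k‖ * Real.exp (-ρ t * freqNorm k) := freqNorm_mul_norm_unweight_le ρ v t k
      _ ≤ ‖v‖ * Real.exp (-(τ / 2) * freqNorm k) := by
          have h1 := lp.norm_apply_le_norm (p := 1) one_ne_zero v k
          have h2 := mul_le_mul_of_nonneg_right (hρτ t) (freqNorm_nonneg k)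
          have h3 : -ρ t * freqNorm k ≤ -(τ / 2) * freqNorm k := by linarith
          exact mul_le_mul h1 (Real.exp_le_exp.mpr h3) (Real.exp_pos _).le (norm_nonneg _)
  · by_cases hk : k = 0
    · subst hk
      simp [unweight_zero, ha₀0, hs0, bilin, hm0]
    have hkn := freqNorm_pos hk
    -- On `[0, T]` the weights cancel and the fixed point equation becomes the formula of variation
    -- of constants, whose integrated form is the claim.
    set B : ℝ → ℂ := fun y => s k - bilin m (unweight ρ v y) (unweight ρ v y) k with hB
    have hBc : Continuous B := continuous_const.sub (hbc v v k)
    have hBe : Continuous fun y : ℝ => (Real.exp (μ k * y) : ℂ) * B y := by fun_prop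
    let z : ℝ → ℂ := fun t => (Real.exp (-μ k * t) : ℂ)
      * (a₀ k + ∫ y in (0 : ℝ)..t, (Real.exp (μ k * y) : ℂ) * B y)
    have hz : ∀ t, HasDerivAt z (B t - μ k * z t) t := by
      intro t
      have h1 : HasDerivAt (fun t : ℝ => (Real.exp (-μ k * t) : ℂ))
          ((Real.exp (-μ k * t) * (-μ k) : ℝ) : ℂ) t := by
        refine HasDerivAt.ofReal_comp ?_
        simpa using ((hasDerivAt_id t).const_mul (-μ k)).exp
      have h2 : HasDerivAt (fun t => a₀ k + ∫ y in (0 : ℝ)..t, (Real.exp (μ k * y) : ℂ) * B y)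
          ((Real.exp (μ k * t) : ℂ) * B t) t :=
        (intervalIntegral.integral_hasDerivAt_right (hBe.intervalIntegrable _ _)
          (hBe.stronglyMeasurableAtFilter _ _) hBe.continuousAt).const_add _
      have h3 : (Real.exp (-μ k * t) : ℂ) * (Real.exp (μ k * t) : ℂ) = 1 := by
        rw [← Complex.ofReal_mul, ← Real.exp_add]; simp
      refine (h1.mul h2).congr_deriv ?_
      simp only [z]
      push_cast at h3 ⊢
      linear_combination B t * h3
    have hzu : ∀ t, 0 ≤ t → t ≤ T → unweight ρ v t k = z t := by
      intro t h0 h1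
      have hval : v k t = ((freqNorm k * Real.exp (ρ t * freqNorm k - μ k * t) : ℝ) : ℂ)
          * (a₀ k + ∫ y in (0 : ℝ)..t, (Real.exp (μ k * y) : ℂ) * B y) := by
        conv_lhs => rw [← hv]
        simp only [lp.coeFn_add, Pi.add_apply, BoundedContinuousFunction.add_apply, hL, hQ]
        have hdsub := duhamel_sub (τ := τ) (lam := lam) (T := T) (μ := μ k) (N := freqNorm k)
          (continuous_const (y := s k)) (hbc v v k) t
        have hdneg := duhamel_sub (τ := τ) (lam := lam) (T := T) (μ := μ k) (N := freqNorm k)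
          (continuous_const (y := (0 : ℂ))) (hbc v v k) t
        have hzero : duhamel τ lam T (μ k) (freqNorm k) (fun _ => 0) t = 0 := by simp [duhamel]
        simp only [zero_sub, hzero] at hdneg
        rw [hdneg, add_assoc, ← sub_eq_add_neg, ← hdsub, duhamel, clamp_of_mem h0 h1, mul_add]
      rw [unweight, hval]
      simp only [z]
      have h2 : freqNorm k * Real.exp (ρ t * freqNorm k - μ k * t)
          * (Real.exp (-ρ t * freqNorm k) / freqNorm k) = Real.exp (-μ k * t) := by
        rw [mul_div_assoc', mul_assoc, ← Real.exp_add, mul_div_cancel_left₀ _ hkn.ne']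
        ring_nf
      rw [← h2]
      push_cast
      ring
    have hzc : Continuous z := continuous_iff_continuousAt.mpr fun t => (hz t).continuousAt
    have hFTC := intervalIntegral.integral_eq_sub_of_hasDerivAt (a := 0) (b := t)
      (fun y _ => hz y) (Continuous.intervalIntegrable (by fun_prop) _ _)
    have hz0 : z 0 = a₀ k := by simp [z]
    have hcongr : ∫ y in (0 : ℝ)..t, (s k - μ k * unweight ρ v y k
        - bilin m (unweight ρ v y) (unweight ρ v y) k) = ∫ y in (0 : ℝ)..t, (B y - μ k * z y) := by
      refine intervalIntegral.integral_congr fun y hy => ?_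
      rw [uIcc_of_le ht0] at hy
      simp only [hB]
      rw [hzu y hy.1 (hy.2.trans htT)]
      ring
    rw [hcongr, hFTC, hz0, hzu t ht0 htT]
    ring

end Existence

/-! ### Analytic functions and the decay of their Fourier coefficients -/

lemma gevreyTerm_nonneg (r τ : ℝ) (f : (Fin d → ℝ) → ℝ) (k : Fin d → ℤ) :
    0 ≤ gevreyTerm r τ f k := by
  rw [gevreyTerm]
  split_ifs
  · exact le_rfl
  · have := Real.rpow_nonneg (freqNorm_nonneg k) (2 * r)
    positivity

/-- A bound which does not depend on `r ≥ 1`, because nonzero frequencies have length at least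
one. -/
lemma InAnalyticClass.freqNorm_mul_norm_le {r τ K : ℝ} {f : (Fin d → ℝ) → ℝ}
    (hf : InAnalyticClass r τ f) (hr : 1 ≤ r) (hK : analyticNorm r τ f ≤ K) (k : Fin d → ℤ) :
    freqNorm k * ‖fourierCoefficient f k‖ ≤ K * Real.exp (-τ * freqNorm k) := by
  have hK0 : 0 ≤ K := (Real.sqrt_nonneg _).trans hK
  by_cases hk : k = 0
  · subst hk; simpa using hK0
  have hn := freqNorm_pos hk
  have h1 : gevreyTerm r τ f k ≤ K ^ 2 := by
    refine (hf.summable.le_tsum k fun j _ => gevreyTerm_nonneg r τ f j).trans ?_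
    exact (Real.sqrt_le_left hK0).mp hK
  rw [gevreyTerm, if_neg hk] at h1
  have h2 : freqNorm k ^ (2 * r) * Real.exp (2 * τ * freqNorm k) * ‖fourierCoefficient f k‖ ^ 2
      = (freqNorm k ^ r * Real.exp (τ * freqNorm k) * ‖fourierCoefficient f k‖) ^ 2 := by
    rw [mul_pow, mul_pow, ← Real.rpow_mul_natCast hn.le, ← Real.exp_nat_mul]
    push_cast
    ring_nf
  rw [h2] at h1
  have h3 := abs_le_of_sq_le_sq h1 hK0
  have h4 : freqNorm k ≤ freqNorm k ^ r := by
    simpa using Real.rpow_le_rpow_of_exponent_le (one_le_freqNorm hk) hr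
  have h5 : freqNorm k * Real.exp (τ * freqNorm k) * ‖fourierCoefficient f k‖ ≤ K := by
    refine le_trans ?_ ((le_abs_self _).trans h3)
    gcongr
  calc freqNorm k * ‖fourierCoefficient f k‖
      = (freqNorm k * Real.exp (τ * freqNorm k) * ‖fourierCoefficient f k‖)
        * Real.exp (-τ * freqNorm k) := by
        have : Real.exp (τ * freqNorm k) * Real.exp (-τ * freqNorm k) = 1 := by
          rw [← Real.exp_add]; simp
        linear_combination (-freqNorm k * ‖fourierCoefficient f k‖) * this
    _ ≤ _ := by gcongr

lemma InAnalyticClass.norm_le {r τ K : ℝ} {f : (Fin d → ℝ) → ℝ}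
    (hf : InAnalyticClass r τ f) (hr : 1 ≤ r) (hmean : MeanZero f) (hK : analyticNorm r τ f ≤ K)
    (k : Fin d → ℤ) : ‖fourierCoefficient f k‖ ≤ K * Real.exp (-τ * freqNorm k) := by
  have hK0 : 0 ≤ K := (Real.sqrt_nonneg _).trans hK
  by_cases hk : k = 0
  · subst hk; simpa [fourierCoefficient_zero hmean] using hK0
  · exact (le_mul_of_one_le_left (norm_nonneg _) (one_le_freqNorm hk)).trans
      (hf.freqNorm_mul_norm_le hr hK k)

lemma InAnalyticClass.hasSum {r τ : ℝ} {f : (Fin d → ℝ) → ℝ} (hf : InAnalyticClass r τ f)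
    (hτ : 0 < τ) (hr : 1 ≤ r) (hmean : MeanZero f) (x : Fin d → ℝ) :
    HasSum (fun k => fourierCoefficient f k * character k x) (f x : ℂ) :=
  hasSum_fourier hf.periodic hf.continuous
    (summable_of_decay hτ (fun _ => norm_nonneg _) (hf.norm_le hr hmean le_rfl)) x

/-- Exponentially decaying coefficients define an analytic function, with half the radius and any
exponent `r`, and with a bound depending only on the decay. -/
lemma exists_analyticNorm_bound (r M : ℝ) {σ : ℝ} (hσ : 0 < σ) :
    ∃ M' : ℝ, ∀ (f : (Fin d → ℝ) → ℝ) (c : (Fin d → ℤ) → ℂ),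
      (∀ k, ‖c k‖ ≤ M * Real.exp (-σ * freqNorm k)) →
      (∀ x, HasSum (fun k => c k * character k x) (f x : ℂ)) →
      InAnalyticClass r (σ / 2) f ∧ analyticNorm r (σ / 2) f ≤ M' := by
  have hG := summable_rpow_mul_of_decay (d := d) hσ
    (c := fun k => M ^ 2 * Real.exp (-σ * freqNorm k)) (fun k => by positivity)
    (fun k => le_rfl) (2 * r)
  refine ⟨Real.sqrt (∑' k : Fin d → ℤ, freqNorm k ^ (2 * r)
    * (M ^ 2 * Real.exp (-σ * freqNorm k))), fun f c hc hf => ?_⟩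
  have hcs := summable_of_decay hσ (fun k => norm_nonneg (c k)) hc
  have hfc : fourierCoefficient f = c := funext (fourierCoefficient_of_hasSum hcs hf)
  have hle : ∀ k, gevreyTerm r (σ / 2) f k
      ≤ freqNorm k ^ (2 * r) * (M ^ 2 * Real.exp (-σ * freqNorm k)) := by
    intro k
    have hp := Real.rpow_nonneg (freqNorm_nonneg k) (2 * r)
    rw [gevreyTerm]
    split_ifs with hk
    · positivity
    · rw [hfc, mul_assoc]
      refine mul_le_mul_of_nonneg_left ?_ hp
      calc _ ≤ Real.exp (2 * (σ / 2) * freqNorm k) * (M * Real.exp (-σ * freqNorm k)) ^ 2 := by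
            gcongr; exact hc k
        _ = M ^ 2 * (Real.exp (2 * (σ / 2) * freqNorm k) * (Real.exp (-σ * freqNorm k)
            * Real.exp (-σ * freqNorm k))) := by ring
        _ = _ := by
            rw [← Real.exp_add, ← Real.exp_add]; ring_nf
  have hs : Summable (gevreyTerm r (σ / 2) f) :=
    Summable.of_nonneg_of_le (gevreyTerm_nonneg r _ f) hle hG
  refine ⟨⟨fun x n => ?_, ?_, hs⟩, Real.sqrt_le_sqrt (hs.tsum_le_tsum hle hG)⟩
  · have h1 := hf fun i => x i + 2 * Real.pi * (n i : ℝ)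
    simp only [character_periodic] at h1
    exact_mod_cast h1.unique (hf x)
  · have h1 : Continuous fun x => ∑' k, c k * character k x :=
      continuous_tsum (fun k => by fun_prop) hcs
        (fun k x => by rw [norm_mul, norm_character, mul_one])
    have h2 : f = fun x => (∑' k, c k * character k x).re :=
      funext fun x => by rw [(hf x).tsum_eq, Complex.ofReal_re]
    rw [h2]
    exact Complex.continuous_re.comp h1

/-! ### From Fourier coefficients to a solution of the equation -/

/-- Decaying coefficients which solve the integrated Fourier-side system give an analytic solution.
Only the values of `a` on `[0, Tmax]` matter; the other hypotheses are global for convenience. -/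
lemma exists_analyticSolution {C₀ : ℝ} {T : Fin d → Fin d → (Fin d → ℤ) → ℂ}
    (hC₀ : 0 ≤ C₀) (hT : AdmissibleSymbol C₀ T) (r κ γ : ℝ) {S θ₀ : (Fin d → ℝ) → ℝ}
    {a₀ s : (Fin d → ℤ) → ℂ} (hs : Summable fun k => ‖s k‖)
    (hS : ∀ x, HasSum (fun k => s k * character k x) (S x : ℂ))
    (hθ₀ : ∀ x, HasSum (fun k => a₀ k * character k x) (θ₀ x : ℂ))
    {a : ℝ → (Fin d → ℤ) → ℂ} {M σ Tmax : ℝ} (hσ : 0 < σ) (hTmax : 0 < Tmax)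
    (hac : ∀ k, Continuous fun t => a t k)
    (ha : ∀ t k, ‖a t k‖ ≤ M * Real.exp (-σ * freqNorm k)) (ha0 : ∀ t, a t 0 = 0)
    (haconj : ∀ t k, a t (-k) = (starRingEnd ℂ) (a t k))
    (heq : ∀ t, 0 ≤ t → t ≤ Tmax → ∀ k,
      a t k = a₀ k + ∫ y in (0 : ℝ)..t, rhsCoeff κ γ T s (a y) k) :
    ∃ θ : ℝ → (Fin d → ℝ) → ℝ, IsAnalyticSolution r κ γ T S θ₀ Tmax θ := by
  have hM : 0 ≤ M := by simpa using (norm_nonneg _).trans (ha 0 0)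
  have hsum : ∀ t, Summable fun k => ‖a t k‖ := fun t =>
    summable_of_decay hσ (fun k => norm_nonneg _) (ha t)
  let θ : ℝ → (Fin d → ℝ) → ℝ := fun t x => (∑' k, a t k * character k x).re
  have hθ : ∀ t x, HasSum (fun k => a t k * character k x) (θ t x : ℂ) := fun t x =>
    hasSum_re_of_conj (hsum t) (haconj t) x
  obtain ⟨G, hG, hGle⟩ := exists_rhsCoeff_majorant hC₀ hT κ γ hs hM hσ
  have hgc : ∀ k, Continuous fun t => rhsCoeff κ γ T s (a t) k := by
    intro k
    have hd0 : ∀ k : Fin d → ℤ, 0 ≤ M * Real.exp (-σ * freqNorm k) := fun k => by positivity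
    have h1 := summable_freqNorm_mul_of_decay hσ hd0 fun _ => le_rfl
    have hle : ∀ t k, freqNorm k * ‖a t k‖ ≤ freqNorm k * (M * Real.exp (-σ * freqNorm k)) :=
      fun t k => mul_le_mul_of_nonneg_left (ha t k) (freqNorm_nonneg k)
    have := continuous_bilin (norm_transportKernel_le hC₀ hT) (by positivity) hac hac h1 h1
      hle hle k
    have := hac k
    unfold rhsCoeff
    fun_prop
  refine ⟨θ, ?_, fun t _ => ?_, fun T' _ => ?_, fun t ht x => ?_⟩
  · funext x
    have h0 : a 0 = a₀ := funext fun k => by simpa using heq 0 le_rfl hTmax.le k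
    have := hθ 0 x
    rw [h0] at this
    exact_mod_cast this.unique (hθ₀ x)
  · refine meanZero_of_fourierCoefficient ?_
    rw [fourierCoefficient_of_hasSum (hsum t) (hθ t), ha0]
  · obtain ⟨M', hM'⟩ := exists_analyticNorm_bound (d := d) r M hσ
    exact ⟨σ / 2, half_pos hσ, M', fun t _ => hM' (θ t) (a t) (ha t) (hθ t)⟩
  · -- The integral form extends every coefficient to a `C¹` function on the whole line.
    let A : (Fin d → ℤ) → ℝ → ℂ := fun k t =>
      (a₀ k + ∫ y in (0 : ℝ)..t, rhsCoeff κ γ T s (a y) k) * character k x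
    have hA : ∀ k t, HasDerivAt (A k) (rhsCoeff κ γ T s (a t) k * character k x) t := fun k t =>
      ((intervalIntegral.integral_hasDerivAt_right ((hgc k).intervalIntegrable _ _)
        ((hgc k).stronglyMeasurableAtFilter _ _) (hgc k).continuousAt).const_add _).mul_const _
    have hAs : Summable fun k => A k 0 := by simpa [A] using (hθ₀ x).summable
    have hder := hasDerivAt_tsum hG hA (fun k t => by
      rw [norm_mul, norm_character, mul_one]
      exact hGle (a t) (ha t) k) hAs t
    rw [(hasSum_rhs hC₀ hT κ γ hS hσ (ha t) (hθ t) x).tsum_eq] at hder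
    have hre := (Complex.reCLM.hasFDerivAt.comp_hasDerivAt t hder).hasDerivWithinAt
      (s := Ico 0 Tmax)
    simp only [Complex.reCLM_apply, Complex.ofReal_re] at hre
    have hcongr : ∀ y ∈ Ico 0 Tmax, θ y x = (Complex.reCLM ∘ fun t => ∑' k, A k t) y := by
      intro y hy
      simp only [θ, A, Function.comp_apply, Complex.reCLM_apply, ← heq y hy.1 hy.2.le]
    exact hre.congr hcongr (hcongr t ht)

/-! ### Uniqueness -/

/-- The differential form of the estimate `norm_duhamel_le`: a damped equation `w' = -μ w - β` started from zero with
forcing of size `D exp (-ρ(t) N)`, where `ρ` decreases at rate `lam`, stays below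
`D exp (-ρ(t) N) / (lam N)`. -/
lemma norm_le_of_damped {w β : ℝ → ℂ} {μ N lam D ρ₀ t₀ t₁ : ℝ} (hμ : 0 ≤ μ) (hN : 0 < N)
    (hlam : 0 < lam) (hD : 0 ≤ D) (hw : ContinuousOn w (Icc t₀ t₁)) (hw0 : w t₀ = 0)
    (hw' : ∀ t ∈ Ico t₀ t₁, HasDerivWithinAt w (-μ * w t - β t) (Ici t) t)
    (hβ : ∀ t ∈ Ico t₀ t₁, ‖β t‖ ≤ D * Real.exp (-(ρ₀ - lam * (t - t₀)) * N)) {t : ℝ}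
    (ht : t ∈ Icc t₀ t₁) :
    ‖w t‖ ≤ D / (lam * N) * Real.exp (-(ρ₀ - lam * (t - t₀)) * N) := by
  have hexp : ∀ t : ℝ, HasDerivAt (fun t : ℝ => (Real.exp (μ * t) : ℂ))
      ((Real.exp (μ * t) * μ : ℝ) : ℂ) t := fun t => by
    refine HasDerivAt.ofReal_comp ?_
    simpa using ((hasDerivAt_id t).const_mul μ).exp
  have hB : ∀ t : ℝ, HasDerivAt
      (fun t => D / (lam * N) * Real.exp (μ * t + -(ρ₀ - lam * (t - t₀)) * N))
      (D / (lam * N) * (Real.exp (μ * t + -(ρ₀ - lam * (t - t₀)) * N) * (μ + lam * N))) t := by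
    intro t
    refine (HasDerivAt.exp ?_).const_mul _
    have h1 : HasDerivAt (fun t : ℝ => (μ + lam * N) * t + (-ρ₀ - lam * t₀) * N)
        (μ + lam * N) t := by
      simpa using ((hasDerivAt_id t).const_mul (μ + lam * N)).add_const ((-ρ₀ - lam * t₀) * N)
    refine h1.congr_of_eventuallyEq (Eventually.of_forall fun y => ?_)
    ring
  have key := image_norm_le_of_norm_deriv_right_le_deriv_boundary (a := t₀) (b := t₁)
    (f := fun t => (Real.exp (μ * t) : ℂ) * w t) (f' := fun t => -((Real.exp (μ * t) : ℂ) * β t))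
    (ContinuousOn.mul (Continuous.continuousOn (by fun_prop)) hw)
    (fun t ht => ((hexp t).hasDerivWithinAt.mul (hw' t ht)).congr_deriv (by push_cast; ring))
    (by rw [hw0, mul_zero, norm_zero]; positivity) hB
    (fun t ht => by
      rw [norm_neg, norm_mul, Complex.norm_real, Real.norm_of_nonneg (Real.exp_pos _).le,
        Real.exp_add]
      have h2 : D ≤ D / (lam * N) * (μ + lam * N) := by
        rw [div_mul_eq_mul_div, le_div_iff₀ (by positivity)]
        nlinarith
      calc _ ≤ Real.exp (μ * t) * (D * Real.exp (-(ρ₀ - lam * (t - t₀)) * N)) := by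
            gcongr; exact hβ t ht
        _ = D * (Real.exp (μ * t) * Real.exp (-(ρ₀ - lam * (t - t₀)) * N)) := by ring
        _ ≤ (D / (lam * N) * (μ + lam * N))
            * (Real.exp (μ * t) * Real.exp (-(ρ₀ - lam * (t - t₀)) * N)) := by gcongr
        _ = _ := by ring) ht
  rw [norm_mul, Complex.norm_real, Real.norm_of_nonneg (Real.exp_pos _).le, Real.exp_add] at key
  have hpos := Real.exp_pos (μ * t)
  refine le_of_mul_le_mul_left (key.trans (le_of_eq ?_)) hpos
  ring

section Coefficients

variable {m : (Fin d → ℤ) → (Fin d → ℤ) → ℂ} {C : ℝ}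

/-- Uniqueness for the Fourier-side system on a short time interval, whose length depends only on
the decay of the two solutions. -/
lemma coeff_unique_of_short (hC : 0 ≤ C) (hm : ∀ j l, ‖m j l‖ ≤ C * freqNorm j * freqNorm l)
    {μ : (Fin d → ℤ) → ℝ} (hμ : ∀ k, 0 ≤ μ k) {s : (Fin d → ℤ) → ℂ} {M σ lam t₀ t₁ : ℝ}
    (hσ : 0 < σ) (hM : 0 ≤ M) (hlam : 0 < lam)
    (hlamV : 2 * C * (∑' k : Fin d → ℤ, freqNorm k * (M * Real.exp (-(σ / 2) * freqNorm k))) < lam)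
    (ht : t₀ ≤ t₁) (hlen : lam * (t₁ - t₀) ≤ σ / 2) {a b : ℝ → (Fin d → ℤ) → ℂ}
    (ha : ∀ t ∈ Icc t₀ t₁, ∀ k, ‖a t k‖ ≤ M * Real.exp (-σ * freqNorm k))
    (hb : ∀ t ∈ Icc t₀ t₁, ∀ k, ‖b t k‖ ≤ M * Real.exp (-σ * freqNorm k))
    (hac : ∀ k, ContinuousOn (fun t => a t k) (Icc t₀ t₁))
    (hbc : ∀ k, ContinuousOn (fun t => b t k) (Icc t₀ t₁))
    (ha' : ∀ t ∈ Ico t₀ t₁, ∀ k, HasDerivWithinAt (fun t => a t k)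
      (s k - μ k * a t k - bilin m (a t) (a t) k) (Ici t) t)
    (hb' : ∀ t ∈ Ico t₀ t₁, ∀ k, HasDerivWithinAt (fun t => b t k)
      (s k - μ k * b t k - bilin m (b t) (b t) k) (Ici t) t)
    (hzero : ∀ t ∈ Icc t₀ t₁, a t 0 = b t 0) (hinit : a t₀ = b t₀) :
    ∀ t ∈ Icc t₀ t₁, a t = b t := by
  -- Half of the radius `σ` is spent on the summability of `V`, the rest shrinks at rate `lam`.
  let ρ : ℝ → ℝ := fun t => σ / 2 - lam * (t - t₀)
  have hρ0 : ∀ t ∈ Icc t₀ t₁, 0 ≤ ρ t := fun t h => by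
    have : lam * (t - t₀) ≤ lam * (t₁ - t₀) := by
      have := h.2; gcongr
    simp only [ρ]; linarith
  have hρle : ∀ t ∈ Icc t₀ t₁, ρ t ≤ σ / 2 := fun t h => by
    have : 0 ≤ lam * (t - t₀) := mul_nonneg hlam.le (sub_nonneg.mpr h.1)
    simp only [ρ]; linarith
  let V : (Fin d → ℤ) → ℝ := fun k => freqNorm k * (M * Real.exp (-(σ / 2) * freqNorm k))
  have hV0 : ∀ k, 0 ≤ V k := fun k => mul_nonneg (freqNorm_nonneg k) (by positivity)
  have hV : Summable V :=
    summable_freqNorm_mul_of_decay (half_pos hσ) (fun k => by positivity) fun _ => le_rfl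
  have hbd : ∀ c : (Fin d → ℤ) → ℂ, (∀ k, ‖c k‖ ≤ M * Real.exp (-σ * freqNorm k)) →
      ∀ t ∈ Icc t₀ t₁, ∀ k, freqNorm k * ‖c k‖ ≤ V k * Real.exp (-ρ t * freqNorm k) := by
    intro c hc t ht k
    have hn := freqNorm_nonneg k
    calc freqNorm k * ‖c k‖ ≤ freqNorm k * (M * Real.exp (-σ * freqNorm k)) := by
          gcongr; exact hc k
      _ ≤ freqNorm k * (M * (Real.exp (-(σ / 2) * freqNorm k)
          * Real.exp (-ρ t * freqNorm k))) := by
          rw [← Real.exp_add]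
          gcongr
          nlinarith [mul_le_mul_of_nonneg_right (hρle t ht) hn]
      _ = _ := by simp only [V]; ring
  let w : ℝ → (Fin d → ℤ) → ℂ := fun t k => a t k - b t k
  -- `W k` is the supremum in time of the weighted difference of the two solutions.
  let W : (Fin d → ℤ) → ℝ := fun k =>
    ⨆ t : Icc t₀ t₁, freqNorm k * ‖w t k‖ * Real.exp (ρ t * freqNorm k)
  have : Nonempty (Icc t₀ t₁) := ⟨⟨t₀, left_mem_Icc.mpr ht⟩⟩
  have hwV : ∀ (t : Icc t₀ t₁) k,
      freqNorm k * ‖w t k‖ * Real.exp (ρ t * freqNorm k) ≤ 2 * V k := by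
    intro t k
    have h1 := hbd _ (ha t t.2) t t.2 k
    have h2 := hbd _ (hb t t.2) t t.2 k
    have h3 : freqNorm k * ‖w t k‖ ≤ 2 * V k * Real.exp (-ρ t * freqNorm k) := by
      have := mul_le_mul_of_nonneg_left (norm_sub_le (a t k) (b t k)) (freqNorm_nonneg k)
      simp only [w]; linarith
    have h4 : Real.exp (-ρ t * freqNorm k) * Real.exp (ρ t * freqNorm k) = 1 := by
      rw [← Real.exp_add]; simp
    calc _ ≤ 2 * V k * Real.exp (-ρ t * freqNorm k) * Real.exp (ρ t * freqNorm k) := by gcongr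
      _ = 2 * V k := by rw [mul_assoc, h4, mul_one]
  have hW2V : ∀ k, W k ≤ 2 * V k := fun k => ciSup_le fun t => hwV t k
  have hleW : ∀ t ∈ Icc t₀ t₁, ∀ k,
      freqNorm k * ‖w t k‖ ≤ W k * Real.exp (-ρ t * freqNorm k) := by
    intro t ht k
    have h1 : freqNorm k * ‖w t k‖ * Real.exp (ρ t * freqNorm k) ≤ W k :=
      le_ciSup (f := fun t : Icc t₀ t₁ => freqNorm k * ‖w t k‖ * Real.exp (ρ t * freqNorm k))
        ⟨2 * V k, by rintro _ ⟨t, rfl⟩; exact hwV t k⟩ ⟨t, ht⟩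
    have h4 : Real.exp (ρ t * freqNorm k) * Real.exp (-ρ t * freqNorm k) = 1 := by
      rw [← Real.exp_add]; simp
    calc freqNorm k * ‖w t k‖ = freqNorm k * ‖w t k‖ * Real.exp (ρ t * freqNorm k)
          * Real.exp (-ρ t * freqNorm k) := by rw [mul_assoc _ (Real.exp _), h4, mul_one]
      _ ≤ _ := by gcongr
  have hW0 : ∀ k, 0 ≤ W k := fun k => Real.iSup_nonneg fun t =>
    mul_nonneg (mul_nonneg (freqNorm_nonneg k) (norm_nonneg _)) (Real.exp_pos _).le
  have hW : Summable W := Summable.of_nonneg_of_le hW0 hW2V (hV.mul_left 2)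
  have hcWV := hasSum_conv hW0 hV0 hW hV
  have hcVW := hasSum_conv hV0 hW0 hV hW
  let D : (Fin d → ℤ) → ℝ := fun k =>
    C * (∑' j, W j * V (k - j)) + C * ∑' j, V j * W (k - j)
  have hD0 : ∀ k, 0 ≤ D k := fun k => add_nonneg
    (mul_nonneg hC (tsum_nonneg fun j => mul_nonneg (hW0 _) (hV0 _)))
    (mul_nonneg hC (tsum_nonneg fun j => mul_nonneg (hV0 _) (hW0 _)))
  have hDs : HasSum D (2 * C * (∑' k, V k) * ∑' k, W k) := by
    have := (hcWV.mul_left C).add (hcVW.mul_left C)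
    convert! this using 1
    ring
  have hWD : ∀ k, W k ≤ D k / lam := by
    intro k
    by_cases hk : k = 0
    · subst hk
      refine (ciSup_le fun t => ?_).trans (div_nonneg (hD0 0) hlam.le)
      simp
    have hkn := freqNorm_pos hk
    refine ciSup_le fun t => ?_
    have hsummable : ∀ c : (Fin d → ℤ) → ℂ, (∀ k, ‖c k‖ ≤ M * Real.exp (-σ * freqNorm k)) →
        Summable fun k => freqNorm k * ‖c k‖ := fun c hc =>
      summable_freqNorm_mul_of_decay hσ (fun k => norm_nonneg _) hc
    have hest := norm_le_of_damped (w := fun t => w t k)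
      (β := fun t => bilin m (w t) (a t) k + bilin m (b t) (w t) k) (ρ₀ := σ / 2)
      (hμ k) hkn hlam (hD0 k) ((hac k).sub (hbc k)) (by simp [w, hinit])
      (fun y hy => by
        have hy' := Ico_subset_Icc_self hy
        have h1 := hsummable _ (ha y hy')
        have h2 := hsummable _ (hb y hy')
        refine ((ha' y hy k).sub (hb' y hy k)).congr_deriv ?_
        simp only [w]
        rw [bilin_sub_left hm h1 h2 h1, bilin_sub_right hm h2 h1 h2]
        ring)
      (fun y hy => by
        have hy' := Ico_subset_Icc_self hy
        refine (norm_add_le _ _).trans ?_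
        have h1 := norm_bilin_le_of_weight hC hm (hρ0 y hy') hW hV (hleW y hy')
          (hbd _ (ha y hy') y hy') k
        have h2 := norm_bilin_le_of_weight hC hm (hρ0 y hy') hV hW
          (hbd _ (hb y hy') y hy') (hleW y hy') k
        refine (add_le_add h1 h2).trans (le_of_eq ?_)
        simp only [D, ρ]
        ring) t.2
    have h4 : Real.exp (-ρ t * freqNorm k) * Real.exp (ρ t * freqNorm k) = 1 := by
      rw [← Real.exp_add]; simp
    calc freqNorm k * ‖w t k‖ * Real.exp (ρ t * freqNorm k)
        ≤ freqNorm k * (D k / (lam * freqNorm k) * Real.exp (-ρ t * freqNorm k))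
          * Real.exp (ρ t * freqNorm k) := by gcongr
      _ = freqNorm k * (D k / (lam * freqNorm k)) := by
          linear_combination (freqNorm k * (D k / (lam * freqNorm k))) * h4
      _ = D k / lam := by field_simp
  have hsum : ∑' k, W k ≤ (2 * C * ∑' k, V k) / lam * ∑' k, W k := by
    refine (hW.tsum_le_tsum hWD (hDs.div_const lam).summable).trans (le_of_eq ?_)
    rw [(hDs.div_const lam).tsum_eq]; ring
  have hq : (2 * C * ∑' k, V k) / lam < 1 := (div_lt_one hlam).mpr hlamV
  have hWsum : ∑' k, W k = 0 := by
    have : 0 ≤ ∑' k, W k := tsum_nonneg hW0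
    nlinarith
  have hWz : ∀ k, W k = 0 := fun k =>
    le_antisymm ((hW.le_tsum k fun j _ => hW0 j).trans hWsum.le) (hW0 k)
  intro t ht
  funext k
  by_cases hk : k = 0
  · subst hk; exact hzero t ht
  have h1 := hleW t ht k
  rw [hWz, zero_mul] at h1
  have h2 : ‖w t k‖ = 0 := le_antisymm
    (nonpos_of_mul_nonpos_right h1 (freqNorm_pos hk)) (norm_nonneg _)
  exact sub_eq_zero.mp (norm_eq_zero.mp h2)

/-- Uniqueness for the Fourier-side system, by stepping forward in time. -/
lemma coeff_unique (hC : 0 ≤ C) (hm : ∀ j l, ‖m j l‖ ≤ C * freqNorm j * freqNorm l)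
    {μ : (Fin d → ℤ) → ℝ} (hμ : ∀ k, 0 ≤ μ k) {s : (Fin d → ℤ) → ℂ} {M σ T' : ℝ}
    (hσ : 0 < σ) (hM : 0 ≤ M) {a b : ℝ → (Fin d → ℤ) → ℂ}
    (ha : ∀ t ∈ Icc 0 T', ∀ k, ‖a t k‖ ≤ M * Real.exp (-σ * freqNorm k))
    (hb : ∀ t ∈ Icc 0 T', ∀ k, ‖b t k‖ ≤ M * Real.exp (-σ * freqNorm k))
    (hac : ∀ k, ContinuousOn (fun t => a t k) (Icc 0 T'))
    (hbc : ∀ k, ContinuousOn (fun t => b t k) (Icc 0 T'))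
    (ha' : ∀ t ∈ Ico 0 T', ∀ k, HasDerivWithinAt (fun t => a t k)
      (s k - μ k * a t k - bilin m (a t) (a t) k) (Ici t) t)
    (hb' : ∀ t ∈ Ico 0 T', ∀ k, HasDerivWithinAt (fun t => b t k)
      (s k - μ k * b t k - bilin m (b t) (b t) k) (Ici t) t)
    (hzero : ∀ t ∈ Icc 0 T', a t 0 = b t 0) (hinit : a 0 = b 0) :
    ∀ t ∈ Icc 0 T', a t = b t := by
  set V := ∑' k : Fin d → ℤ, freqNorm k * (M * Real.exp (-(σ / 2) * freqNorm k)) with hV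
  have hV0 : 0 ≤ V := tsum_nonneg fun k => mul_nonneg (freqNorm_nonneg k) (by positivity)
  set lam := 2 * C * V + 1 with hlam
  have hlam0 : 0 < lam := by positivity
  set h := σ / 2 / lam with hh
  have hh0 : 0 < h := by positivity
  have hstep : ∀ n : ℕ, ∀ t ∈ Icc 0 T', t ≤ n * h → a t = b t := by
    intro n
    induction n with
    | zero =>
      intro t ht htn
      have : t = 0 := le_antisymm (by simpa using htn) ht.1
      rw [this, hinit]
    | succ n ih =>
      intro t ht htn
      rcases le_total t (n * h) with hle | hle
      · exact ih t ht hle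
      have hn0 : 0 ≤ n * h := by positivity
      have hsub : Icc (n * h) t ⊆ Icc 0 T' := Icc_subset_Icc hn0 ht.2
      have hsub' : Ico (n * h) t ⊆ Ico 0 T' := Ico_subset_Ico hn0 ht.2
      refine coeff_unique_of_short hC hm hμ hσ hM hlam0 (by linarith) hle ?_
        (fun y hy => ha y (hsub hy)) (fun y hy => hb y (hsub hy))
        (fun k => (hac k).mono hsub) (fun k => (hbc k).mono hsub)
        (fun y hy => ha' y (hsub' hy)) (fun y hy => hb' y (hsub' hy))
        (fun y hy => hzero y (hsub hy))
        (ih _ (hsub (left_mem_Icc.mpr hle)) le_rfl) t (right_mem_Icc.mpr hle)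
      have h1 : t - n * h ≤ h := by push_cast at htn; linarith
      calc lam * (t - n * h) ≤ lam * h := by gcongr
        _ = σ / 2 := by rw [hh]; field_simp
  intro t ht
  obtain ⟨n, hn⟩ := exists_nat_ge (t / h)
  exact hstep n t ht ((div_le_iff₀ hh0).mp hn)

end Coefficients

namespace IsAnalyticSolution

variable {r κ γ Tmax : ℝ} {T : Fin d → Fin d → (Fin d → ℤ) → ℂ} {S θ₀ : (Fin d → ℝ) → ℝ}
  {θ : ℝ → (Fin d → ℝ) → ℝ}

/-- On `[0, T']` the coefficients of an analytic solution decay exponentially at a uniform rate. -/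
lemma exists_decay (h : IsAnalyticSolution r κ γ T S θ₀ Tmax θ) (hr : 1 ≤ r) {T' : ℝ}
    (hT' : T' < Tmax) :
    ∃ σ M : ℝ, 0 < σ ∧ 0 ≤ M ∧ ∀ t ∈ Icc 0 T', Continuous (θ t) ∧
      (∀ k, ‖fourierCoefficient (θ t) k‖ ≤ M * Real.exp (-σ * freqNorm k)) ∧
      ∀ x, HasSum (fun k => fourierCoefficient (θ t) k * character k x) (θ t x : ℂ) := by
  obtain ⟨σ, hσ, M, hM⟩ := h.analytic T' hT'
  refine ⟨σ, |M|, hσ, abs_nonneg M, fun t ht => ?_⟩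
  obtain ⟨h1, h2⟩ := hM t ht
  have hmean := h.mean_zero t ⟨ht.1, ht.2.trans_lt hT'⟩
  exact ⟨h1.continuous, h1.norm_le hr hmean (h2.trans (le_abs_self M)), h1.hasSum hσ hr hmean⟩

/-- The Fourier coefficients of an analytic solution solve the Fourier-side system. -/
lemma hasDerivWithinAt_coeff {C₀ : ℝ} (h : IsAnalyticSolution r κ γ T S θ₀ Tmax θ) (hr : 1 ≤ r)
    (hC₀ : 0 ≤ C₀) (hT : AdmissibleSymbol C₀ T)
    (hs : Summable fun k => ‖fourierCoefficient S k‖)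
    (hS : ∀ x, HasSum (fun k => fourierCoefficient S k * character k x) (S x : ℂ))
    {t : ℝ} (ht : t ∈ Ico 0 Tmax) (k : Fin d → ℤ) :
    HasDerivWithinAt (fun t => fourierCoefficient (θ t) k)
      (rhsCoeff κ γ T (fourierCoefficient S) (fourierCoefficient (θ t)) k) (Ico 0 Tmax) t := by
  obtain ⟨T', htT', hT'⟩ := exists_between ht.2
  obtain ⟨σ, M, hσ, hM, hdec⟩ := h.exists_decay hr hT'
  obtain ⟨G, hG, hGle⟩ := exists_rhsCoeff_majorant hC₀ hT κ γ hs hM hσ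
  set F : ℝ → (Fin d → ℝ) → ℝ := fun t x => S x - κ * fracLaplacian γ (θ t) x
    - ∑ j, velocity T (θ t) j x * fderiv ℝ (θ t) x (Pi.single j 1) with hF
  have hsum : ∀ y ∈ Icc 0 T', ∀ x, HasSum (fun k =>
      rhsCoeff κ γ T (fourierCoefficient S) (fourierCoefficient (θ y)) k * character k x)
      (F y x : ℂ) := fun y hy =>
    hasSum_rhs hC₀ hT κ γ hS hσ (hdec y hy).2.1 (hdec y hy).2.2
  have hFle : ∀ y ∈ Icc 0 T', ∀ x, ‖F y x‖ ≤ ∑' k, G k := by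
    intro y hy x
    rw [← Complex.norm_real, ← (hsum y hy x).tsum_eq]
    refine tsum_of_norm_bounded hG.hasSum fun k => ?_
    rw [norm_mul, norm_character, mul_one]
    exact hGle _ (hdec y hy).2.1 k
  have htI : t ∈ Icc 0 T' := ⟨ht.1, htT'.le⟩
  have hsubset : Icc 0 T' ⊆ Ico 0 Tmax := fun y hy => ⟨hy.1, hy.2.trans_lt hT'⟩
  have hnear : ∀ᶠ y in 𝓝[Ico 0 Tmax \ {t}] t, y ∈ Icc 0 T' := by
    filter_upwards [self_mem_nhdsWithin, mem_nhdsWithin_of_mem_nhds (Iio_mem_nhds htT')]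
      with y hy1 hy2
    exact ⟨hy1.1.1, le_of_lt hy2⟩
  have hFc : fourierCoefficient (F t)
      = rhsCoeff κ γ T (fourierCoefficient S) (fourierCoefficient (θ t)) :=
    funext (fourierCoefficient_of_hasSum
      (Summable.of_nonneg_of_le (fun _ => norm_nonneg _) (hGle _ (hdec t htI).2.1) hG)
      (hsum t htI))
  rw [← hFc]
  refine hasDerivWithinAt_fourierCoefficient (L := ∑' k, G k)
    (hnear.mono fun y hy => (hdec y hy).1) (hdec t htI).1 (h.equation t ht) ?_ k
  filter_upwards [hnear] with y hy x
  exact (convex_Icc 0 T').norm_image_sub_le_of_norm_hasDerivWithin_le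
    (fun z hz => (h.equation z (hsubset hz) x).mono hsubset) (fun z hz => hFle z hz x) htI hy

lemma eq_of_same_data {C₀ : ℝ} {θ₁ θ₂ : ℝ → (Fin d → ℝ) → ℝ}
    (h₁ : IsAnalyticSolution r κ γ T S θ₀ Tmax θ₁) (h₂ : IsAnalyticSolution r κ γ T S θ₀ Tmax θ₂)
    (hr : 1 ≤ r) (hκ : 0 ≤ κ) (hC₀ : 0 ≤ C₀) (hT : AdmissibleSymbol C₀ T)
    (hs : Summable fun k => ‖fourierCoefficient S k‖)
    (hS : ∀ x, HasSum (fun k => fourierCoefficient S k * character k x) (S x : ℂ))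
    {t : ℝ} (ht : t ∈ Ico 0 Tmax) : θ₁ t = θ₂ t := by
  obtain ⟨σ₁, M₁, hσ₁, hM₁, hd₁⟩ := h₁.exists_decay hr ht.2
  obtain ⟨σ₂, M₂, hσ₂, hM₂, hd₂⟩ := h₂.exists_decay hr ht.2
  have hsubset : Icc 0 t ⊆ Ico 0 Tmax := fun y hy => ⟨hy.1, hy.2.trans_lt ht.2⟩
  have hright : ∀ y ∈ Ico 0 t, Ico 0 Tmax ∈ 𝓝[Ici y] y := fun y hy =>
    mem_of_superset (Ico_mem_nhdsGE (hy.2.trans ht.2)) (Ico_subset_Ico_left hy.1)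
  have hweak : ∀ {σ M : ℝ}, M ≤ max M₁ M₂ → min σ₁ σ₂ ≤ σ → ∀ k : Fin d → ℤ,
      M * Real.exp (-σ * freqNorm k)
        ≤ max M₁ M₂ * Real.exp (-min σ₁ σ₂ * freqNorm k) := by
    intro σ M hM hσ k
    have := freqNorm_nonneg k
    have : 0 ≤ max M₁ M₂ := hM₁.trans (le_max_left _ _)
    gcongr
  have hder : ∀ {θ : ℝ → (Fin d → ℝ) → ℝ}, IsAnalyticSolution r κ γ T S θ₀ Tmax θ →
      (∀ k, ContinuousOn (fun t => fourierCoefficient (θ t) k) (Icc 0 t)) ∧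
      ∀ y ∈ Ico 0 t, ∀ k, HasDerivWithinAt (fun t => fourierCoefficient (θ t) k)
        (rhsCoeff κ γ T (fourierCoefficient S) (fourierCoefficient (θ y)) k) (Ici y) y :=
    fun h => ⟨fun k y hy => ((h.hasDerivWithinAt_coeff hr hC₀ hT hs hS (hsubset hy)
        k).continuousWithinAt).mono hsubset, fun y hy k =>
      (h.hasDerivWithinAt_coeff hr hC₀ hT hs hS (hsubset (Ico_subset_Icc_self hy))
        k).mono_of_mem_nhdsWithin (hright y hy)⟩
  have hcoeff := coeff_unique (C := C₀ * d ^ 2) (by positivity) (norm_transportKernel_le hC₀ hT)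
    (μ := fun k => κ * freqNorm k ^ γ) (s := fourierCoefficient S)
    (fun k => mul_nonneg hκ (Real.rpow_nonneg (freqNorm_nonneg k) γ))
    (lt_min hσ₁ hσ₂) (hM₁.trans (le_max_left M₁ M₂))
    (a := fun y => fourierCoefficient (θ₁ y)) (b := fun y => fourierCoefficient (θ₂ y))
    (fun y hy k => ((hd₁ y hy).2.1 k).trans (hweak (le_max_left _ _) (min_le_left _ _) k))
    (fun y hy k => ((hd₂ y hy).2.1 k).trans (hweak (le_max_right _ _) (min_le_right _ _) k))
    (hder h₁).1 (hder h₂).1 (hder h₁).2 (hder h₂).2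
    (fun y hy => by
      rw [fourierCoefficient_zero (h₁.mean_zero y (hsubset hy)),
        fourierCoefficient_zero (h₂.mean_zero y (hsubset hy))])
    (by rw [h₁.initial, h₂.initial]) t (right_mem_Icc.mpr ht.1)
  have htI : t ∈ Icc 0 t := right_mem_Icc.mpr ht.1
  funext x
  have e1 := (hd₁ t htI).2.2 x
  rw [hcoeff] at e1
  exact_mod_cast e1.unique ((hd₂ t htI).2.2 x)

end IsAnalyticSolution

end ActiveScalar

/-! ### Local well-posedness -/

theorem theorem5p1 (d : ℕ) (hd : 2 ≤ d) (C₀ τ₀ K₀ : ℝ)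
    (hC₀ : 0 < C₀) (hτ₀ : 0 < τ₀) (hK₀ : 0 < K₀) :
    ∃ Tstar : ℝ, 0 < Tstar ∧
      ∀ (r κ γ : ℝ), (d : ℝ) / 2 + 5 / 2 < r → 0 ≤ κ → 0 < γ → γ ≤ 2 →
      ∀ T : Fin d → Fin d → (Fin d → ℤ) → ℂ, ActiveScalar.AdmissibleSymbol C₀ T →
      ∀ θ₀ S : (Fin d → ℝ) → ℝ,
        ActiveScalar.InAnalyticClass r τ₀ θ₀ → ActiveScalar.InAnalyticClass r τ₀ S →
        ActiveScalar.MeanZero θ₀ → ActiveScalar.MeanZero S →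
        ActiveScalar.analyticNorm r τ₀ θ₀ ≤ K₀ → ActiveScalar.analyticNorm r τ₀ S ≤ K₀ →
        (∃ θ : ℝ → (Fin d → ℝ) → ℝ,
          ActiveScalar.IsAnalyticSolution r κ γ T S θ₀ Tstar θ) ∧
        (∀ θ₁ θ₂ : ℝ → (Fin d → ℝ) → ℝ,
          ActiveScalar.IsAnalyticSolution r κ γ T S θ₀ Tstar θ₁ →
          ActiveScalar.IsAnalyticSolution r κ γ T S θ₀ Tstar θ₂ →
          ∀ t ∈ Set.Ico 0 Tstar, θ₁ t = θ₂ t) := by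
  open ActiveScalar in
  set Z : ℝ := ∑' k : Fin d → ℤ, Real.exp (-(τ₀ / 2) * freqNorm k) with hZ
  have hZs := summable_exp_freqNorm (d := d) (half_pos hτ₀)
  have hZ0 : 0 ≤ Z := tsum_nonneg fun k => (Real.exp_pos _).le
  set C : ℝ := C₀ * d ^ 2 with hC
  have hC0 : 0 ≤ C := by positivity
  -- The data have size at most `2 K₀ Z` in the radius `τ₀ / 2`; this rate makes the
  -- nonlinearity a contraction on a ball of twice that size.
  set lam : ℝ := 1 + 8 * C * K₀ * Z with hlam
  have hlam1 : 1 ≤ lam := by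
    have : 0 ≤ 8 * C * K₀ * Z := by positivity
    linarith
  have hlam0 : 0 < lam := zero_lt_one.trans_le hlam1
  refine ⟨τ₀ / 2 / (2 * lam), by positivity, ?_⟩
  intro r κ γ hr hκ _ _ T hT θ₀ S hθ₀ hS hθ₀m hSm hθ₀K hSK
  have hr1 : 1 ≤ r := by
    have : (0 : ℝ) ≤ d := Nat.cast_nonneg d
    linarith
  have hSsum : Summable fun k => ‖fourierCoefficient S k‖ :=
    summable_of_decay hτ₀ (fun _ => norm_nonneg _) (hS.norm_le hr1 hSm hSK)
  refine ⟨?_, fun θ₁ θ₂ h₁ h₂ t ht => h₁.eq_of_same_data h₂ hr1 hκ hC₀.le hT hSsum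
    (hS.hasSum hτ₀ hr1 hSm) ht⟩
  have hsplit : ∀ k : Fin d → ℤ, Real.exp (τ₀ / 2 * freqNorm k)
      * (K₀ * Real.exp (-τ₀ * freqNorm k)) = K₀ * Real.exp (-(τ₀ / 2) * freqNorm k) := by
    intro k
    rw [mul_left_comm, ← Real.exp_add]
    ring_nf
  have hle1 : ∀ k, freqNorm k * Real.exp (τ₀ / 2 * freqNorm k) * ‖fourierCoefficient θ₀ k‖
      ≤ K₀ * Real.exp (-(τ₀ / 2) * freqNorm k) := by
    intro k
    rw [← hsplit, mul_comm (freqNorm k), mul_assoc]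
    refine mul_le_mul_of_nonneg_left ?_ (Real.exp_pos _).le
    exact hθ₀.freqNorm_mul_norm_le hr1 hθ₀K k
  have hle2 : ∀ k, Real.exp (τ₀ / 2 * freqNorm k) * ‖fourierCoefficient S k‖
      ≤ K₀ * Real.exp (-(τ₀ / 2) * freqNorm k) := by
    intro k
    rw [← hsplit]
    gcongr
    exact hS.norm_le hr1 hSm hSK k
  have hs1 := Summable.of_nonneg_of_le (fun k => mul_nonneg (mul_nonneg (freqNorm_nonneg k)
    (Real.exp_pos _).le) (norm_nonneg _)) hle1 (hZs.mul_left K₀)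
  have hs2 := Summable.of_nonneg_of_le (fun k => mul_nonneg (Real.exp_pos _).le (norm_nonneg _))
    hle2 (hZs.mul_left K₀)
  have hsum1 := hs1.tsum_le_tsum hle1 (hZs.mul_left K₀)
  have hsum2 := hs2.tsum_le_tsum hle2 (hZs.mul_left K₀)
  rw [tsum_mul_left, ← hZ] at hsum1 hsum2
  have hsmall : 4 * (C / lam) * (2 * K₀ * Z) < 1 := by
    have : 4 * (C / lam) * (2 * K₀ * Z) = 8 * C * K₀ * Z / lam := by ring
    rw [this, div_lt_one hlam0]
    linarith
  obtain ⟨a, M, hac, ha, ha0, haconj, heq⟩ := exists_coeff_solution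
    (μ := fun k => κ * freqNorm k ^ γ) hC0 (norm_transportKernel_le hC₀.le hT)
    (transportKernel_neg hT) (transportKernel_self_neg hT) (half_pos hτ₀) hlam0
    (fun k => mul_nonneg hκ (Real.rpow_nonneg (freqNorm_nonneg k) γ)) (fun k => by simp)
    (fourierCoefficient_zero hθ₀m) (fourierCoefficient_zero hSm)
    (fourierCoefficient_neg θ₀) (fourierCoefficient_neg S) hs1 hs2
    (by
      have h2 : (∑' k, Real.exp (τ₀ / 2 * freqNorm k) * ‖fourierCoefficient S k‖) / lam
          ≤ K₀ * Z := (div_le_self (tsum_nonneg fun k => by positivity) hlam1).trans hsum2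
      linarith) hsmall
  exact exists_analyticSolution hC₀.le hT r κ γ hSsum (hS.hasSum hτ₀ hr1 hSm)
    (hθ₀.hasSum hτ₀ hr1 hθ₀m) (half_pos (half_pos hτ₀)) (by positivity) hac ha ha0 haconj heq
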